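/- Consider the class of equations \[ u_{tt}=f(x,u_x)\,u_{xx}+g(x,u_x) \qquad (1) \] for $u=u(t,x)$, where the tuple of arbitrary elements $\theta=(f,g)$ runs through the pairs of real $C^\infty$ functions of $(x,u_x)$, each pair defined on an open set $W\subseteq\mathbb R^2$, with $(f_{u_x},g_{u_xu_x})\neq(0,0)$, i.e. $f_{u_x}$ and $g_{u_xu_x}$ do not both vanish identically on $W$. A point transformation is a $C^\infty$ diffeomorphism between open subsets of a space. The usual equivalence (pseudo)group $G^\sim$ of the class (1) consists of the point transformations $\Phi$, with open domain $M$, of the space of $(t,x,u,u_t,u_x,f,g)$ such that: $\Phi$ is projectable to a point transformation $\Phi|_{(t,x,u)}$ of the space of $(t,x,u)$ and to a point transformation of the space of $(t,x,u,u_t,u_x)$, the latter being the first-order prolongation of $\Phi|_{(t,x,u)}$; and for every tuple $\theta$ of arbitrary elements whose domain $W$ is exactly the set of $(x,u_x)$ over which its graph meets $M$, the image under $\Phi$ of the part in $M$ of the graph of $\theta$ is the part in $\Phi(M)$ of the graph of a tuple $\tilde\theta$ of arbitrary elements of the class (whose domain is again the set of points over which its graph meets $\Phi(M)$), and $\Phi|_{(t,x,u)}$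 maps the equation (1) for $\theta$ to the one for $\tilde\theta$, i.e. over the first-order jets concerned, a second-order jet satisfies the first equation if and only if its image under the second-order prolongation of $\Phi|_{(t,x,u)}$ satisfies the second. Say that $\Phi$ has the form (2) on a set $N$ if there are constants $c_0,\dots,c_4$ with $c_1c_2\ne0$ and $C^\infty$ functions $\varphi,\psi$ of $x$ with $\varphi_x\neq0$, defined on the projection of $N$ to the $x$-axis, such that on $N$ \[ \begin{aligned} &\tilde t=c_1t+c_0,\quad \tilde x=\varphi(x),\quad \tilde u=c_2u+c_4t^2+c_3t+\psi(x),\\ &\tilde u_{\tilde t}=\frac{c_2u_t+2c_4t+c_3}{c_1},\quad \tilde u_{\tilde x}=\frac{c_2u_x+\psi_x}{\varphi_x},\\ &\tilde f=\frac{\varphi_x^2}{c_1^2}f,\quad \tilde g=\frac1{c_1^2}\Bigl(c_2g+\frac{c_2u_x+\psi_x}{\varphi_x}\varphi_{xx}f-\psi_{xx}f+2c_4\Bigr). \end{aligned}\qquad(2) \] Theorem. Let $M$ be an open subset of the space of $(t,x,u,u_t,u_x,f,g)$, let $D$ be its projection to the space of $(t,x,u)$, and let $\Phi$ be a map from $M$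 to that space. (i) If $\Phi$ belongs to $G^\sim$, then every point of $M$ has an open neighbourhood in $M$ on which $\Phi$ has the form (2). (ii) If $D$ is connected and all its slices $\{(t,x,u)\in D: x=\mathrm{const}\}$ are connected or empty (for example, if $D$ is nonempty and convex), then $\Phi$ belongs to $G^\sim$ if and only if $\Phi$ has the form (2) on $M$. -/

import Mathlib

open scoped ContDiff

noncomputable section

namespace WaveClass

/-- The space of the variables `(t, x, u)`. -/
abbrev Base := ℝ × ℝ × ℝ

/-- The first-order jet space, with points `((t, x, u), (u_t, u_x))`. -/
abbrev Jet := Base × (ℝ × ℝ)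

/-- The extended space, with points `(((t, x, u), (u_t, u_x)), (f, g))`. -/
abbrev Ext := Jet × (ℝ × ℝ)

/-- A (local) point transformation of a space `E` with domain `D`: a smooth, injective and
nondegenerate map on an open set, i.e. a diffeomorphism of `D` onto an open subset of `E`. -/
structure IsPointTransformation {E : Type*} [NormedAddCommGroup E] [NormedSpace ℝ E]
    (φ : E → E) (D : Set E) : Prop where
  isOpen : IsOpen D
  smooth : ContDiffOn ℝ ∞ φ D
  injOn : Set.InjOn φ D
  nondegenerate : ∀ z ∈ D, Function.Bijective (fderiv ℝ φ z)

/-! ### Prolongation -/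

/-- Total derivative `D_t = ∂_t + u_t ∂_u` of `φ = (T, X, U)` at a first-order jet. -/
def totalT (φ : Base → Base) (j : Jet) : Base := fderiv ℝ φ j.1 (1, 0, j.2.1)

/-- Total derivative `D_x = ∂_x + u_x ∂_u` of `φ = (T, X, U)` at a first-order jet. -/
def totalX (φ : Base → Base) (j : Jet) : Base := fderiv ℝ φ j.1 (0, 1, j.2.2)

/-- Total derivative `D_t = ∂_t + u_t ∂_u + u_tt ∂_{u_t} + u_tx ∂_{u_x}` of a map on the
first-order jet space, where `r = u_tt` and `s = u_tx`. -/
def totalT' (φ₁ : Jet → Jet) (j : Jet) (r s : ℝ) : Jet :=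
  fderiv ℝ φ₁ j ((1, 0, j.2.1), (r, s))

/-- Total derivative `D_x = ∂_x + u_x ∂_u + u_tx ∂_{u_t} + u_xx ∂_{u_x}` of a map on the
first-order jet space, where `s = u_tx` and `q = u_xx`. -/
def totalX' (φ₁ : Jet → Jet) (j : Jet) (s q : ℝ) : Jet :=
  fderiv ℝ φ₁ j ((0, 1, j.2.2), (s, q))

/-- The total Jacobian `Δ = D_t T · D_x X - D_t X · D_x T`. -/
def totalJac (φ : Base → Base) (j : Jet) : ℝ :=
  (totalT φ j).1 * (totalX φ j).2.1 - (totalT φ j).2.1 * (totalX φ j).1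

/-- The derivative with respect to the new variable `t̃` of a quantity with total derivatives
`ht = D_t h` and `hx = D_x h`, i.e. `(D_x X · D_t h - D_t X · D_x h) / Δ`. -/
def newT (φ : Base → Base) (j : Jet) (ht hx : ℝ) : ℝ :=
  ((totalX φ j).2.1 * ht - (totalT φ j).2.1 * hx) / totalJac φ j

/-- The derivative with respect to the new variable `x̃` of a quantity with total derivatives
`ht = D_t h` and `hx = D_x h`, i.e. `(D_t T · D_x h - D_x T · D_t h) / Δ`. -/
def newX (φ : Base → Base) (j : Jet) (ht hx : ℝ) : ℝ :=
  ((totalT φ j).1 * hx - (totalX φ j).1 * ht) / totalJac φ j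

/-- On the set `J` of jets, `φ₁` is the first-order prolongation of `φ = (T, X, U)`: it has the
components `T`, `X`, `U`, and `ũ_t̃`, `ũ_x̃` are obtained from `U` by the chain rule. -/
def IsFirstProlongation (φ : Base → Base) (φ₁ : Jet → Jet) (J : Set Jet) : Prop :=
  ∀ j ∈ J, totalJac φ j ≠ 0 ∧
    φ₁ j = (φ j.1, (newT φ j (totalT φ j).2.2 (totalX φ j).2.2,
                    newX φ j (totalT φ j).2.2 (totalX φ j).2.2))

/-- The component `ũ_t̃t̃` of the second-order prolongation, at the second-order jet over `j` with
`r = u_tt`, `s = u_tx`, `q = u_xx`. -/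
def newTT (φ : Base → Base) (φ₁ : Jet → Jet) (j : Jet) (r s q : ℝ) : ℝ :=
  newT φ j (totalT' φ₁ j r s).2.1 (totalX' φ₁ j s q).2.1

/-- The component `ũ_x̃x̃` of the second-order prolongation, at the second-order jet over `j` with
`r = u_tt`, `s = u_tx`, `q = u_xx`. -/
def newXX (φ : Base → Base) (φ₁ : Jet → Jet) (j : Jet) (r s q : ℝ) : ℝ :=
  newX φ j (totalT' φ₁ j r s).2.2 (totalX' φ₁ j s q).2.2

/-! ### The class of equations -/

/-- The arguments `(x, u_x)` of the arbitrary elements at a first-order jet. -/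
def arg (j : Jet) : ℝ × ℝ := (j.1.2.1, j.2.2)

/-- The set of arbitrary elements `θ = (f, g)` of the class
`u_tt = f(x,u_x) u_xx + g(x,u_x)`, for the domain `W` of `f` and `g`: smooth functions with
`(f_{u_x}, g_{u_x u_x}) ≠ (0, 0)` (an inequality between pairs of functions on `W`). -/
structure IsArbitraryElement (θ : ℝ × ℝ → ℝ × ℝ) (W : Set (ℝ × ℝ)) : Prop where
  isOpen : IsOpen W
  smooth : ContDiffOn ℝ ∞ θ W
  nonlinear : ∃ w ∈ W, deriv (fun p => (θ (w.1, p)).1) w.2 ≠ 0 ∨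
    deriv (deriv (fun p => (θ (w.1, p)).2)) w.2 ≠ 0

/-- The part of the graph of `θ = (f, g) : W → ℝ²` lying in a subset `M` of the extended space. -/
def graphIn (θ : ℝ × ℝ → ℝ × ℝ) (W : Set (ℝ × ℝ)) (M : Set Ext) : Set Ext :=
  {m | m ∈ M ∧ arg m.1 ∈ W ∧ m.2 = θ (arg m.1)}

/-- `W` consists exactly of those `(x, u_x)` over which the graph of `θ` meets `M`. -/
def FitsIn (θ : ℝ × ℝ → ℝ × ℝ) (W : Set (ℝ × ℝ)) (M : Set Ext) : Prop :=
  (fun m : Ext => arg m.1) '' graphIn θ W M = W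

/-- The second-order jet with first-order part `j` and `r = u_tt`, `q = u_xx` satisfies
`u_tt = f(x,u_x) u_xx + g(x,u_x)`, where `θ = (f, g)`. -/
def Satisfies (θ : ℝ × ℝ → ℝ × ℝ) (j : Jet) (r q : ℝ) : Prop :=
  r = (θ (arg j)).1 * q + (θ (arg j)).2

/-- The second-order prolongation of `φ` maps the equation with arbitrary elements `θ` to the
one with arbitrary elements `θ'`, over the set `J` of first-order jets. -/
def MapsEquation (φ : Base → Base) (φ₁ : Jet → Jet) (θ θ' : ℝ × ℝ → ℝ × ℝ) (J : Set Jet) : Prop :=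
  ∀ j ∈ J, ∀ r s q : ℝ, Satisfies θ j r q ↔
    Satisfies θ' (φ₁ j) (newTT φ φ₁ j r s q) (newXX φ φ₁ j r s q)

/-- The projection of `M` to the space of `(t, x, u, u_t, u_x)`. -/
def jetDomain (M : Set Ext) : Set Jet := Prod.fst '' M

/-- The projection of `M` to the space of `(t, x, u)`. -/
def baseDomain (M : Set Ext) : Set Base := Prod.fst '' jetDomain M

/-- The projection of `M` to the `x`-axis. -/
def xDomain (M : Set Ext) : Set ℝ := (fun z : Base => z.2.1) '' baseDomain M

/-- `Φ`, with domain `M`, belongs to the usual equivalence (pseudo)group of the class: it is a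
point transformation of the extended space, projectable to a point transformation `φ` of the
variable space and to the first-order prolongation `φ₁` of `φ`; the image under `Φ` of each tuple
`θ` of arbitrary elements is again a tuple `θ'` of arbitrary elements of the class, and `φ` maps
the equation for `θ` to the equation for `θ'`. -/
def IsEquivalenceTransformation (Φ : Ext → Ext) (M : Set Ext) : Prop :=
  IsPointTransformation Φ M ∧
  ∃ (φ : Base → Base) (φ₁ : Jet → Jet),
    IsPointTransformation φ (baseDomain M) ∧
    IsPointTransformation φ₁ (jetDomain M) ∧
    (∀ m ∈ M, (Φ m).1.1 = φ m.1.1) ∧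
    (∀ m ∈ M, (Φ m).1 = φ₁ m.1) ∧
    IsFirstProlongation φ φ₁ (jetDomain M) ∧
    ∀ (θ : ℝ × ℝ → ℝ × ℝ) (W : Set (ℝ × ℝ)), IsArbitraryElement θ W → FitsIn θ W M →
      ∃ (θ' : ℝ × ℝ → ℝ × ℝ) (W' : Set (ℝ × ℝ)),
        IsArbitraryElement θ' W' ∧ FitsIn θ' W' (Φ '' M) ∧
        Φ '' graphIn θ W M = graphIn θ' W' (Φ '' M) ∧
        MapsEquation φ φ₁ θ θ' (jetDomain (graphIn θ W M))

/-- `Φ` is given on `M` by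
`t̃ = c₁ t + c₀`, `x̃ = φ(x)`, `ũ = c₂ u + c₄ t² + c₃ t + ψ(x)`,
`ũ_t̃ = (c₂ u_t + 2 c₄ t + c₃) / c₁`, `ũ_x̃ = (c₂ u_x + ψ_x) / φ_x`, `f̃ = φ_x² f / c₁²`,
`g̃ = (c₂ g + (c₂ u_x + ψ_x) φ_xx f / φ_x - ψ_xx f + 2 c₄) / c₁²`,
with constants `c₀, …, c₄`, `c₁ c₂ ≠ 0`, and smooth `φ`, `ψ`, `φ_x ≠ 0`. -/
def HasExplicitForm (Φ : Ext → Ext) (M : Set Ext) : Prop :=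
  ∃ (c₀ c₁ c₂ c₃ c₄ : ℝ) (φ ψ : ℝ → ℝ),
    c₁ * c₂ ≠ 0 ∧
    ContDiffOn ℝ ∞ φ (xDomain M) ∧ ContDiffOn ℝ ∞ ψ (xDomain M) ∧
    (∀ x ∈ xDomain M, deriv φ x ≠ 0) ∧
    ∀ t x u ut ux f g : ℝ, (((t, x, u), (ut, ux)), (f, g)) ∈ M →
      Φ (((t, x, u), (ut, ux)), (f, g)) =
        (((c₁ * t + c₀, φ x, c₂ * u + c₄ * t ^ 2 + c₃ * t + ψ x),
          ((c₂ * ut + 2 * c₄ * t + c₃) / c₁, (c₂ * ux + deriv ψ x) / deriv φ x)),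
         (deriv φ x ^ 2 / c₁ ^ 2 * f,
          1 / c₁ ^ 2 * (c₂ * g + (c₂ * ux + deriv ψ x) / deriv φ x * deriv (deriv φ) x * f
            - deriv (deriv ψ) x * f + 2 * c₄)))

end WaveClass

end

/-!
The statement rests on two conditions on `Φ` that involve no arbitrary elements
(`IsPointwiseEquivalence`). A tuple `θ` can be prescribed at any two points `(x, u_x)`
(`exists_smooth_through`). Prescribing it at one point, `u_tt = f u_xx + g` must be mapped to
`ũ_tt = f̃ ũ_xx + g̃` at each point of `M`, where `(f̃, g̃)` is the value of `Φ`. Prescribing it at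
two points, `(f̃, g̃)` must agree at two points of `M` that can lie on one graph and have the same new
arguments `(x̃, ũ_x̃)`; were the old arguments `(x, u_x)` of these points different, the values
`(f, g)` over them could be varied freely, against injectivity of `Φ`. So `(x̃, ũ_x̃)` determines
`(x, u_x)`.

Infinitesimally, since the prolongation `φ₁` of `φ = (T, X, U)` is a local diffeomorphism,
`(x̃, ũ_x̃)` depends on `(x, u_x)` only (`IsPointTransformation.map_ker_of_fiber`). Hence
`X = X(x)`, and differentiating `D_x U = ũ_t̃ D_x T + ũ_x̃ D_x X` with respect to `u_t` gives
`D_x T = 0`, that is `T = T(t)`. What remains, `U_x + u_x U_u = ũ_x̃ X_x`, does not depend on `t` and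
`u`, so that `U = c₂ u + ρ(t) + ψ(x)` on boxes (`IsPointwiseEquivalence.exists_eq_sepMap`).
For such `φ` the second prolongation is explicit, and comparison of coefficients gives
`f̃ = X_x² f / T_t²` together with a formula for `g̃`. As these are determined by `(x, u_x, f, g)`,
both `T_t²` and `ρ_tt` are constant, which is the explicit form on a box
(`IsPointwiseEquivalence.exists_explicitForm`).

The constants in the local forms are unique, hence locally constant on the projection of `M` to the
space of `(t, x, u)`, and so are the values of the two functions of `x` on its slices; connectedness
makes the local forms into one (`IsEquivalenceTransformation.hasExplicitForm`). Conversely, `φ_x ≠ 0`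
on an interval makes `φ` injective, so a map of the explicit form is injective and induces a
diffeomorphism of the arguments `(x, u_x)`, by which tuples of arbitrary elements are pushed forward
(`HasExplicitForm.isEquivalenceTransformation`).
-/

open scoped ContDiff Topology
open Set Filter

namespace WaveClass

/-! ### Domains and sections -/

theorem isOpen_jetDomain {M : Set Ext} (hM : IsOpen M) : IsOpen (jetDomain M) :=
  isOpenMap_fst _ hM

theorem isOpen_baseDomain {M : Set Ext} (hM : IsOpen M) : IsOpen (baseDomain M) :=
  isOpenMap_fst _ (isOpen_jetDomain hM)

theorem isOpen_xDomain {M : Set Ext} (hM : IsOpen M) : IsOpen (xDomain M) :=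
  (isOpenMap_fst.comp isOpenMap_snd) _ (isOpen_baseDomain hM)

theorem isOpenMap_arg : IsOpenMap arg := by
  have h : arg = Prod.map (fun z : Base => z.2.1) (fun p : ℝ × ℝ => p.2) := rfl
  rw [h]
  exact (isOpenMap_fst.comp isOpenMap_snd).prodMap isOpenMap_snd

theorem continuous_arg : Continuous arg := by unfold arg; fun_prop

/-- An everywhere smooth pair `(f, g)` with prescribed values at two points `(x, u_x)`, which may
coincide, and with `f_{u_x} ≠ 0` at the first one. -/
theorem exists_smooth_through (w₁ w₂ v₁ v₂ : ℝ × ℝ) (h : w₁ = w₂ → v₁ = v₂) :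
    ∃ θ : ℝ × ℝ → ℝ × ℝ, ContDiff ℝ ∞ θ ∧ θ w₁ = v₁ ∧ θ w₂ = v₂ ∧
      deriv (fun p => (θ (w₁.1, p)).1) w₁.2 ≠ 0 := by
  -- `l` vanishes to second order at `w₁` and is `1` at `w₂`; when `w₁ = w₂`, the division by
  -- `d = 0` makes it `0` everywhere.
  set d : ℝ := (w₂.1 - w₁.1) ^ 2 + (w₂.2 - w₁.2) ^ 2 with hd
  let l : ℝ × ℝ → ℝ := fun w => ((w.1 - w₁.1) ^ 2 + (w.2 - w₁.2) ^ 2) / d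
  have hl₁ : l w₁ = 0 := by simp [l]
  refine ⟨fun w => (v₁.1 + (v₂.1 - v₁.1) * l w + (w.2 - w₁.2) * (1 - l w),
    v₁.2 + (v₂.2 - v₁.2) * l w), ?_, ?_, ?_, ?_⟩
  · simp only [l]
    fun_prop
  · simp [hl₁]
  · by_cases hw : w₁ = w₂
    · subst hw
      rw [← h rfl]
      simp [hl₁]
    · have hd0 : d ≠ 0 := by
        intro h0
        apply hw
        have h1 : w₂.1 - w₁.1 = 0 := by nlinarith [sq_nonneg (w₂.1 - w₁.1), sq_nonneg (w₂.2 - w₁.2)]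
        have h2 : w₂.2 - w₁.2 = 0 := by nlinarith [sq_nonneg (w₂.1 - w₁.1), sq_nonneg (w₂.2 - w₁.2)]
        ext <;> linarith
      have hl₂ : l w₂ = 1 := div_self hd0
      simp [hl₂]
  · have hl : HasDerivAt (fun p : ℝ => l (w₁.1, p)) 0 w₁.2 := by
      have := ((((hasDerivAt_id w₁.2).sub_const w₁.2).pow 2).const_add
        ((w₁.1 - w₁.1) ^ 2)).div_const d
      simpa [l] using this
    have h1 := ((hl.const_mul (v₂.1 - v₁.1)).const_add v₁.1).add
      (((hasDerivAt_id w₁.2).sub_const w₁.2).mul (hl.const_sub 1))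
    have h2 : deriv (fun p => v₁.1 + (v₂.1 - v₁.1) * l (w₁.1, p) +
        (p - w₁.2) * (1 - l (w₁.1, p))) w₁.2 = 1 := by
      have := h1.deriv
      simp [hl₁] at this
      exact this
    simp only
    rw [h2]
    exact one_ne_zero

/-- Restricting an everywhere smooth pair to the points over which its graph meets `M` gives a
tuple of arbitrary elements that fits in `M`. -/
theorem exists_fitting {M : Set Ext} (hM : IsOpen M) {θ : ℝ × ℝ → ℝ × ℝ} (hθ : ContDiff ℝ ∞ θ)
    {j : Jet} (hj : (j, θ (arg j)) ∈ M)
    (hd : deriv (fun p => (θ ((arg j).1, p)).1) (arg j).2 ≠ 0) :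
    ∃ W, IsArbitraryElement θ W ∧ FitsIn θ W M ∧
      ∀ j', (j', θ (arg j')) ∈ M → (j', θ (arg j')) ∈ graphIn θ W M := by
  refine ⟨arg '' {j | (j, θ (arg j)) ∈ M}, ⟨?_, hθ.contDiffOn, arg j, ⟨j, hj, rfl⟩, Or.inl hd⟩,
    ?_, fun j' hj' => ⟨hj', ⟨j', hj', rfl⟩, rfl⟩⟩
  · apply isOpenMap_arg
    exact hM.preimage (continuous_id.prodMk (hθ.continuous.comp continuous_arg))
  · ext w
    constructor
    · rintro ⟨m, ⟨_, hm, _⟩, rfl⟩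
      exact hm
    · rintro ⟨j', hj', rfl⟩
      exact ⟨(j', θ (arg j')), ⟨hj', ⟨j', hj', rfl⟩, rfl⟩, rfl⟩

/-! ### Pointwise consequences of equivalence -/

/-- The conditions on an equivalence transformation that involve no arbitrary elements. -/
structure IsPointwiseEquivalence (Φ : Ext → Ext) (M : Set Ext) (φ : Base → Base)
    (φ₁ : Jet → Jet) : Prop where
  isOpen : IsOpen M
  base : IsPointTransformation φ (baseDomain M)
  jet : IsPointTransformation φ₁ (jetDomain M)
  fst_eq : ∀ m ∈ M, (Φ m).1 = φ₁ m.1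
  prolongation : IsFirstProlongation φ φ₁ (jetDomain M)
  /-- The equation with coefficients `(f, g)` at a point is mapped to the one with `(f̃, g̃)`. -/
  equation : ∀ m ∈ M, ∀ r s q : ℝ, r = m.2.1 * q + m.2.2 ↔
    newTT φ φ₁ m.1 r s q = (Φ m).2.1 * newXX φ φ₁ m.1 r s q + (Φ m).2.2
  /-- Two points on the graph of one tuple of arbitrary elements have images on the graph of one
  tuple of arbitrary elements. -/
  graph : ∀ m₁ ∈ M, ∀ m₂ ∈ M, (arg m₁.1 = arg m₂.1 → m₁.2 = m₂.2) →
    arg (φ₁ m₁.1) = arg (φ₁ m₂.1) → (Φ m₁).2 = (Φ m₂).2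
  /-- The new arguments determine the old ones. -/
  arg_eq : ∀ j₁ ∈ jetDomain M, ∀ j₂ ∈ jetDomain M, arg (φ₁ j₁) = arg (φ₁ j₂) → arg j₁ = arg j₂

theorem IsEquivalenceTransformation.exists_pointwise {Φ : Ext → Ext} {M : Set Ext}
    (h : IsEquivalenceTransformation Φ M) :
    ∃ φ φ₁, IsPointwiseEquivalence Φ M φ φ₁ := by
  obtain ⟨hΦ, φ, φ₁, hφ, hφ₁, -, hfst, hpro, hθ⟩ := h
  have hgraph : ∀ m₁ ∈ M, ∀ m₂ ∈ M, (arg m₁.1 = arg m₂.1 → m₁.2 = m₂.2) →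
      arg (φ₁ m₁.1) = arg (φ₁ m₂.1) → (Φ m₁).2 = (Φ m₂).2 := by
    intro m₁ h₁ m₂ h₂ h12 harg
    obtain ⟨θ, hs, e₁, e₂, hd⟩ := exists_smooth_through _ _ _ _ h12
    have p₁ : (m₁.1, θ (arg m₁.1)) = m₁ := by rw [e₁]
    have p₂ : (m₂.1, θ (arg m₂.1)) = m₂ := by rw [e₂]
    obtain ⟨W, hW, hfit, hmem⟩ := exists_fitting hΦ.isOpen hs (p₁.symm ▸ h₁) hd
    obtain ⟨θ', W', -, -, himg, -⟩ := hθ θ W hW hfit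
    have q₁ := himg ▸ mem_image_of_mem Φ (p₁ ▸ hmem m₁.1 (p₁.symm ▸ h₁))
    have q₂ := himg ▸ mem_image_of_mem Φ (p₂ ▸ hmem m₂.1 (p₂.symm ▸ h₂))
    rw [q₁.2.2, q₂.2.2, hfst _ h₁, hfst _ h₂, harg]
  refine ⟨φ, φ₁, hΦ.isOpen, hφ, hφ₁, hfst, hpro, ?_, hgraph, ?_⟩
  · intro m hm r s q
    obtain ⟨θ, hs, e, -, hd⟩ := exists_smooth_through (arg m.1) (arg m.1) m.2 m.2 (fun _ => rfl)
    have p : (m.1, θ (arg m.1)) = m := by rw [e]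
    obtain ⟨W, hW, hfit, hmem⟩ := exists_fitting hΦ.isOpen hs (p.symm ▸ hm) hd
    obtain ⟨θ', W', -, -, himg, hmap⟩ := hθ θ W hW hfit
    have hg : m ∈ graphIn θ W M := p ▸ hmem m.1 (p.symm ▸ hm)
    have q₁ := himg ▸ mem_image_of_mem Φ hg
    have := hmap m.1 ⟨m, hg, rfl⟩ r s q
    rw [Satisfies, Satisfies, e, ← hfst m hm, ← q₁.2.2] at this
    exact this
  · rintro _ ⟨m₁, h₁, rfl⟩ _ ⟨m₂, h₂, rfl⟩ harg
    by_contra hne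
    -- Otherwise `(f̃, g̃)` at `m₁` is that at `m₂` whatever `(f, g)` is at `m₁`, so `Φ` cannot be
    -- injective.
    have hconst : ∀ v, (m₁.1, v) ∈ M → (Φ (m₁.1, v)).2 = (Φ m₂).2 := fun v hv =>
      hgraph _ hv _ h₂ (fun h => absurd h hne) harg
    have hopen : ∀ᶠ ε in 𝓝 (0 : ℝ), (m₁.1, m₁.2 + (ε, (0 : ℝ))) ∈ M := by
      have hc : Continuous fun ε : ℝ => ((m₁.1, m₁.2 + (ε, (0 : ℝ))) : Ext) := by fun_prop
      apply hc.continuousAt.eventually_mem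
      apply hΦ.isOpen.mem_nhds
      have h0 : ((m₁.1, m₁.2 + ((0 : ℝ), (0 : ℝ))) : Ext) = m₁ := by ext <;> simp
      rwa [h0]
    obtain ⟨ε, hε, hε0⟩ : ∃ ε : ℝ, (m₁.1, m₁.2 + (ε, (0 : ℝ))) ∈ M ∧ ε ≠ 0 :=
      ((hopen.filter_mono nhdsWithin_le_nhds).and
        (self_mem_nhdsWithin : {(0 : ℝ)}ᶜ ∈ 𝓝[≠] 0)).exists
    have heq : Φ (m₁.1, m₁.2 + (ε, (0 : ℝ))) = Φ m₁ := by
      apply Prod.ext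
      · rw [hfst _ hε, hfst _ h₁]
      · rw [hconst _ hε, hconst _ h₁]
    have := hΦ.injOn hε h₁ heq
    have := congrArg (fun m : Ext => m.2.1) this
    simp at this
    exact hε0 this

/-! ### Point transformations -/

theorem bijective_of_ker_eq_zero {E : Type*} [NormedAddCommGroup E] [NormedSpace ℝ E]
    [FiniteDimensional ℝ E] (L : E →L[ℝ] E) (h : ∀ v, L v = 0 → v = 0) :
    Function.Bijective L := by
  have h1 : Function.Injective (L : E →ₗ[ℝ] E) := (injective_iff_map_eq_zero _).2 h
  exact ⟨h1, LinearMap.injective_iff_surjective.1 h1⟩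

section

variable {E : Type*} [NormedAddCommGroup E] [NormedSpace ℝ E] [FiniteDimensional ℝ E]
  {F : E → E} {D : Set E}

theorem IsPointTransformation.exists_hasStrictFDerivAt (hF : IsPointTransformation F D) {z : E}
    (hz : z ∈ D) : ∃ L : E ≃L[ℝ] E, (L : E →L[ℝ] E) = fderiv ℝ F z ∧
      HasStrictFDerivAt F (L : E →L[ℝ] E) z := by
  refine ⟨ContinuousLinearEquiv.ofBijective (fderiv ℝ F z)
    (LinearMap.ker_eq_bot.2 (hF.nondegenerate z hz).1)
    (LinearMap.range_eq_top.2 (hF.nondegenerate z hz).2),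
    ContinuousLinearEquiv.coe_ofBijective _ _ _, ?_⟩
  rw [ContinuousLinearEquiv.coe_ofBijective]
  exact (hF.smooth.contDiffAt (hF.isOpen.mem_nhds hz)).hasStrictFDerivAt (by simp)

theorem IsPointTransformation.isOpen_image (hF : IsPointTransformation F D) {s : Set E}
    (hs : IsOpen s) (hsD : s ⊆ D) : IsOpen (F '' s) := by
  have : CompleteSpace E := FiniteDimensional.complete ℝ E
  rw [isOpen_iff_mem_nhds]
  rintro _ ⟨z, hz, rfl⟩
  obtain ⟨L, -, hL⟩ := hF.exists_hasStrictFDerivAt (hsD hz)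
  rw [← hL.map_nhds_eq_of_equiv]
  exact image_mem_map (hs.mem_nhds hz)

/-- The inverse of a point transformation is smooth. -/
theorem IsPointTransformation.contDiffOn_invFunOn [Nonempty E] (hF : IsPointTransformation F D) :
    ContDiffOn ℝ ∞ (Function.invFunOn F D) (F '' D) := by
  have : CompleteSpace E := FiniteDimensional.complete ℝ E
  rintro _ ⟨z, hz, rfl⟩
  obtain ⟨L, -, hL⟩ := hF.exists_hasStrictFDerivAt hz
  have hcd : ContDiffAt ℝ ∞ F z := hF.smooth.contDiffAt (hF.isOpen.mem_nhds hz)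
  have hinv := hcd.to_localInverse hL.hasFDerivAt (by simp)
  refine (hinv.congr_of_eventuallyEq ?_).contDiffWithinAt
  have hr : ∀ᶠ y in 𝓝 (F z), F (hcd.localInverse hL.hasFDerivAt (by simp) y) = y :=
    (hcd.hasStrictFDerivAt' hL.hasFDerivAt (by simp)).eventually_right_inverse
  have hz' : hcd.localInverse hL.hasFDerivAt (by simp) (F z) = z :=
    (hcd.hasStrictFDerivAt' hL.hasFDerivAt (by simp)).localInverse_apply_image
  have hD : ∀ᶠ y in 𝓝 (F z), hcd.localInverse hL.hasFDerivAt (by simp) y ∈ D :=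
    hinv.continuousAt.eventually_mem (hF.isOpen.mem_nhds (by rwa [hz']))
  filter_upwards [hr, hD] with y hy hyD
  conv_lhs => rw [← hy]
  exact hF.injOn.leftInvOn_invFunOn hyD

/-- If the values of a linear map `A` at the points of an open set are determined by its values at
their images under a diffeomorphism `F`, then the derivatives of `F` preserve the kernel of `A`.
A local inverse of `F` maps lines along `ker A` into fibres of `A`, so the inverse of the
derivative preserves `ker A`, and thus, by finiteness of the dimension, so does the derivative. -/
theorem IsPointTransformation.map_ker_of_fiber {G : Type*} [NormedAddCommGroup G]
    [NormedSpace ℝ G] (hF : IsPointTransformation F D) (A : E →L[ℝ] G)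
    (hA : ∀ y ∈ D, ∀ z ∈ D, A (F y) = A (F z) → A y = A z) {z : E} (hz : z ∈ D) {v : E}
    (hv : A v = 0) : A (fderiv ℝ F z v) = 0 := by
  have : CompleteSpace E := FiniteDimensional.complete ℝ E
  obtain ⟨L, hL, hstrict⟩ := hF.exists_hasStrictFDerivAt hz
  set H := hstrict.localInverse F L z with hH
  have hHz : H (F z) = z := hstrict.localInverse_apply_image
  have hHd : HasFDerivAt H (L.symm : E →L[ℝ] E) (F z) := hstrict.to_localInverse.hasFDerivAt
  have hHr : ∀ᶠ y in 𝓝 (F z), F (H y) = y := hstrict.eventually_right_inverse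
  have hHD : ∀ᶠ y in 𝓝 (F z), H y ∈ D :=
    hHd.continuousAt.eventually_mem (hF.isOpen.mem_nhds (hHz.symm ▸ hz))
  have hker : ∀ w, A w = 0 → A (L.symm w) = 0 := by
    intro w hw
    have hline : HasDerivAt (fun s : ℝ => F z + s • w) w 0 := by
      simpa using ((hasDerivAt_id (0 : ℝ)).smul_const w).const_add (F z)
    have htend : Tendsto (fun s : ℝ => F z + s • w) (𝓝 0) (𝓝 (F z)) := by
      simpa using hline.continuousAt.tendsto
    have hHd' : HasFDerivAt H (L.symm : E →L[ℝ] E) (F z + (0 : ℝ) • w) := by simpa using hHd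
    have hHline := hHd'.comp_hasDerivAt (0 : ℝ) hline
    have h1 : HasDerivAt (fun s : ℝ => A (H (F z + s • w))) (A (L.symm w)) 0 :=
      A.hasFDerivAt.comp_hasDerivAt (0 : ℝ) hHline
    have h2 : (fun s : ℝ => A (H (F z + s • w))) =ᶠ[𝓝 0] fun _ => A z := by
      filter_upwards [htend.eventually hHr, htend.eventually hHD] with s hs hsD
      apply hA _ hsD _ hz
      rw [hs]
      simp [hw]
    exact h1.unique ((hasDerivAt_const (0 : ℝ) (A z)).congr_of_eventuallyEq h2)
  let K := LinearMap.ker (A : E →ₗ[ℝ] G)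
  have hle : K.map (L.symm.toLinearEquiv : E →ₗ[ℝ] E) ≤ K := by
    rintro _ ⟨w, hw, rfl⟩
    exact hker w hw
  have heq := Submodule.eq_of_le_of_finrank_eq hle (LinearEquiv.finrank_map_eq _ K)
  obtain ⟨w, hw, rfl⟩ : v ∈ K.map (L.symm.toLinearEquiv : E →ₗ[ℝ] E) := by rw [heq]; exact hv
  rw [← hL]
  change A (L (L.symm w)) = 0
  rw [L.apply_symm_apply]
  exact hw

end

/-! ### Infinitesimal consequences -/

/-- The map `arg` as a linear map. -/
def argL : Jet →L[ℝ] ℝ × ℝ :=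
  ((ContinuousLinearMap.fst ℝ ℝ ℝ).comp (ContinuousLinearMap.snd ℝ ℝ (ℝ × ℝ))).prodMap
    (ContinuousLinearMap.snd ℝ ℝ ℝ)

section

variable {Φ : Ext → Ext} {M : Set Ext} {φ : Base → Base} {φ₁ : Jet → Jet}

theorem IsPointwiseEquivalence.differentiableAt (h : IsPointwiseEquivalence Φ M φ φ₁) {z : Base}
    (hz : z ∈ baseDomain M) : DifferentiableAt ℝ φ z :=
  (h.base.smooth.contDiffAt (h.base.isOpen.mem_nhds hz)).differentiableAt (by simp)

theorem IsPointwiseEquivalence.differentiableAt_jet (h : IsPointwiseEquivalence Φ M φ φ₁) {j : Jet}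
    (hj : j ∈ jetDomain M) : DifferentiableAt ℝ φ₁ j :=
  (h.jet.smooth.contDiffAt (h.jet.isOpen.mem_nhds hj)).differentiableAt (by simp)

theorem IsPointwiseEquivalence.fderiv_fst (h : IsPointwiseEquivalence Φ M φ φ₁) {j : Jet}
    (hj : j ∈ jetDomain M) (v : Jet) : (fderiv ℝ φ₁ j v).1 = fderiv ℝ φ j.1 v.1 := by
  have h1 : HasFDerivAt (fun k => (φ₁ k).1) ((ContinuousLinearMap.fst ℝ Base (ℝ × ℝ)).comp
      (fderiv ℝ φ₁ j)) j :=
    (hasFDerivAt_fst (𝕜 := ℝ) (p := φ₁ j)).comp j (h.differentiableAt_jet hj).hasFDerivAt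
  have h2 : HasFDerivAt (fun k : Jet => φ k.1) ((fderiv ℝ φ j.1).comp
      (ContinuousLinearMap.fst ℝ Base (ℝ × ℝ))) j :=
    (h.differentiableAt ⟨j, hj, rfl⟩).hasFDerivAt.comp j hasFDerivAt_fst
  have h3 : (fun k => (φ₁ k).1) =ᶠ[𝓝 j] fun k : Jet => φ k.1 := by
    filter_upwards [h.jet.isOpen.mem_nhds hj] with k hk
    rw [(h.prolongation k hk).2]
  have := h1.unique (h2.congr_of_eventuallyEq h3)
  exact congrArg (fun l => l v) this

/-- `x̃` and `ũ_x̃` do not depend on `t`, `u`, `u_t`. -/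
theorem IsPointwiseEquivalence.arg_fderiv (h : IsPointwiseEquivalence Φ M φ φ₁) {j : Jet}
    (hj : j ∈ jetDomain M) {v : Jet} (hv : arg v = 0) : arg (fderiv ℝ φ₁ j v) = 0 :=
  h.jet.map_ker_of_fiber argL (fun y hy z hz => h.arg_eq y hy z hz) hj hv

theorem IsPointwiseEquivalence.fderiv_x_eq_zero (h : IsPointwiseEquivalence Φ M φ φ₁) {z : Base}
    (hz : z ∈ baseDomain M) (a b : ℝ) : (fderiv ℝ φ z (a, 0, b)).2.1 = 0 := by
  obtain ⟨j, hj, rfl⟩ := hz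
  have h1 := h.arg_fderiv hj (v := ((a, 0, b), (0, 0))) rfl
  rw [← h.fderiv_fst hj ((a, 0, b), (0, 0))]
  exact congrArg Prod.fst h1

/-- `D_x U = ũ_t̃ D_x T + ũ_x̃ D_x X`. -/
theorem IsFirstProlongation.totalX_eq {J : Set Jet} (h : IsFirstProlongation φ φ₁ J) {j : Jet}
    (hj : j ∈ J) : (totalX φ j).2.2 =
      (φ₁ j).2.1 * (totalX φ j).1 + (φ₁ j).2.2 * (totalX φ j).2.1 := by
  obtain ⟨h0, h1⟩ := h j hj
  rw [h1]
  simp only [newT, newX]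
  field_simp
  rw [totalJac]
  ring

/-- `T` depends on `t` only: differentiating `D_x U = ũ_t̃ D_x T + ũ_x̃ D_x X` with respect to `u_t`
gives `(∂ũ_t̃ / ∂u_t) D_x T = 0`, with nonzero first factor as the prolongation is nondegenerate. -/
theorem IsPointwiseEquivalence.totalX_t_eq_zero (h : IsPointwiseEquivalence Φ M φ φ₁) {j : Jet}
    (hj : j ∈ jetDomain M) : (totalX φ j).1 = 0 := by
  set e : Jet := ((0, 0, 0), (1, 0)) with he
  set w := fderiv ℝ φ₁ j e with hw
  have hw1 : w.1 = 0 := by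
    rw [hw, h.fderiv_fst hj]
    exact map_zero (fderiv ℝ φ j.1)
  have hw2 : w.2.2 = 0 := congrArg Prod.snd (h.arg_fderiv hj (v := e) rfl)
  have hw0 : w ≠ 0 := by
    intro h0
    have : e = 0 := (h.jet.nondegenerate j hj).1 (by rw [← hw, h0, map_zero])
    have := congrArg (fun k : Jet => k.2.1) this
    simp [e] at this
  have hw3 : w.2.1 ≠ 0 := by
    intro h0
    exact hw0 (Prod.ext hw1 (Prod.ext h0 hw2))
  have hline : HasDerivAt (fun s : ℝ => j + s • e) e 0 := by
    simpa using ((hasDerivAt_id (0 : ℝ)).smul_const e).const_add j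
  have hd : HasFDerivAt φ₁ (fderiv ℝ φ₁ j) (j + (0 : ℝ) • e) := by
    simpa using (h.differentiableAt_jet hj).hasFDerivAt
  have h1 : HasDerivAt (fun s : ℝ => φ₁ (j + s • e)) w 0 := hd.comp_hasDerivAt 0 hline
  have hP : HasDerivAt (fun s : ℝ => (φ₁ (j + s • e)).2.1) w.2.1 0 := h1.snd.fst
  have hQ : HasDerivAt (fun s : ℝ => (φ₁ (j + s • e)).2.2) w.2.2 0 := h1.snd.snd
  have htot : ∀ s : ℝ, totalX φ (j + s • e) = totalX φ j := by
    intro s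
    have e1 : (j + s • e).1 = j.1 := by ext <;> simp [e]
    have e2 : (j + s • e).2.2 = j.2.2 := by simp [e]
    rw [totalX, e1, e2, totalX]
  have hev : ∀ᶠ s in 𝓝 (0 : ℝ), j + s • e ∈ jetDomain M :=
    hline.continuousAt.eventually_mem (h.jet.isOpen.mem_nhds (by simpa using hj))
  have hsum := (hP.mul_const (totalX φ j).1).add (hQ.mul_const (totalX φ j).2.1)
  have hcon : (fun s : ℝ => (φ₁ (j + s • e)).2.1 * (totalX φ j).1 +
      (φ₁ (j + s • e)).2.2 * (totalX φ j).2.1) =ᶠ[𝓝 0] fun _ => (totalX φ j).2.2 := by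
    filter_upwards [hev] with s hs
    have := h.prolongation.totalX_eq hs
    rw [htot] at this
    exact this.symm
  have := hsum.unique ((hasDerivAt_const (0 : ℝ) _).congr_of_eventuallyEq hcon)
  rw [hw2, zero_mul, add_zero] at this
  exact (mul_eq_zero.1 this).resolve_left hw3

theorem IsPointwiseEquivalence.fderiv_t_eq_zero (h : IsPointwiseEquivalence Φ M φ φ₁) {z : Base}
    (hz : z ∈ baseDomain M) (a b : ℝ) : (fderiv ℝ φ z (0, a, b)).1 = 0 := by
  obtain ⟨j, hj, rfl⟩ := hz
  have hc : Continuous fun s : ℝ => ((j.1, (j.2.1, j.2.2 + s)) : Jet) := by fun_prop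
  have hev : ∀ᶠ s in 𝓝 (0 : ℝ), ((j.1, (j.2.1, j.2.2 + s)) : Jet) ∈ jetDomain M :=
    hc.continuousAt.eventually_mem (h.jet.isOpen.mem_nhds (by simpa using hj))
  obtain ⟨s, hs, hs0⟩ : ∃ s : ℝ, ((j.1, (j.2.1, j.2.2 + s)) : Jet) ∈ jetDomain M ∧ s ≠ 0 :=
    ((hev.filter_mono nhdsWithin_le_nhds).and
      (self_mem_nhdsWithin : {(0 : ℝ)}ᶜ ∈ 𝓝[≠] 0)).exists
  have h1 : (fderiv ℝ φ j.1 (0, 1, j.2.2)).1 = 0 := h.totalX_t_eq_zero hj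
  have h2 : (fderiv ℝ φ j.1 (0, 1, j.2.2 + s)).1 = 0 := h.totalX_t_eq_zero hs
  have e : ((0, a, b) : Base) = (a - (b - a * j.2.2) / s) • ((0, 1, j.2.2) : Base) +
      ((b - a * j.2.2) / s) • ((0, 1, j.2.2 + s) : Base) := by
    ext
    · simp
    · simp
    · simp
      field_simp
      ring
  rw [e, map_add, map_smul, map_smul]
  simp [h1, h2]

/-- `D_x U = ũ_x̃ X_x`, with a right-hand side that does not depend on `t`, `u`, `u_t`. -/
theorem IsPointwiseEquivalence.fderiv_u_eq (h : IsPointwiseEquivalence Φ M φ φ₁) {j : Jet}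
    (hj : j ∈ jetDomain M) :
    (fderiv ℝ φ j.1 (0, 1, j.2.2)).2.2 = (φ₁ j).2.2 * (fderiv ℝ φ j.1 (0, 1, 0)).2.1 := by
  have h1 := h.prolongation.totalX_eq hj
  rw [h.totalX_t_eq_zero hj, mul_zero, zero_add] at h1
  have h2 : (totalX φ j).2.1 = (fderiv ℝ φ j.1 (0, 1, 0)).2.1 := by
    have e : ((0, 1, j.2.2) : Base) = (0, 1, 0) + (0, 0, j.2.2) := by simp
    rw [totalX, e, map_add]
    simp [h.fderiv_x_eq_zero ⟨j, hj, rfl⟩ 0 j.2.2]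
  rw [h2] at h1
  exact h1

end

/-! ### Prolongation of maps with separated variables -/

/-- The map `(t, x, u) ↦ (τ(t), ξ(x), c u + ρ(t) + ψ(x))`. -/
def sepMap (c : ℝ) (τ ξ ρ ψ : ℝ → ℝ) (z : Base) : Base :=
  (τ z.1, ξ z.2.1, c * z.2.2 + ρ z.1 + ψ z.2.1)

/-- The first-order prolongation of `sepMap`. -/
noncomputable def sepJet (c : ℝ) (τ ξ ρ ψ : ℝ → ℝ) (j : Jet) : Jet :=
  (sepMap c τ ξ ρ ψ j.1, ((c * j.2.1 + deriv ρ j.1.1) / deriv τ j.1.1,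
    (c * j.2.2 + deriv ψ j.1.2.1) / deriv ξ j.1.2.1))

section

variable {c : ℝ} {τ ξ ρ ψ : ℝ → ℝ} {φ : Base → Base} {φ₁ : Jet → Jet}

theorem fderiv_eq_of_hasDerivAt_line {E G : Type*} [NormedAddCommGroup E] [NormedSpace ℝ E]
    [NormedAddCommGroup G] [NormedSpace ℝ G] {F : E → G} {z v : E} {d : G}
    (hF : DifferentiableAt ℝ F z) (h : HasDerivAt (fun s : ℝ => F (z + s • v)) d 0) :
    fderiv ℝ F z v = d :=
  (hF.hasFDerivAt.hasLineDerivAt v).unique h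

theorem _root_.DifferentiableAt.hasDerivAt_add_smul {f : ℝ → ℝ} {a : ℝ}
    (h : DifferentiableAt ℝ f a) (b : ℝ) :
    HasDerivAt (fun s : ℝ => f (a + s * b)) (deriv f a * b) 0 := by
  have h1 : HasDerivAt (fun s : ℝ => a + s * b) b 0 := by
    simpa using ((hasDerivAt_id (0 : ℝ)).mul_const b).const_add a
  have h2 : HasDerivAt f (deriv f a) (a + 0 * b) := by simpa using h.hasDerivAt
  exact h2.comp (0 : ℝ) h1

theorem differentiableAt_sepMap {z : Base} (hτ : DifferentiableAt ℝ τ z.1)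
    (hξ : DifferentiableAt ℝ ξ z.2.1) (hρ : DifferentiableAt ℝ ρ z.1)
    (hψ : DifferentiableAt ℝ ψ z.2.1) : DifferentiableAt ℝ (sepMap c τ ξ ρ ψ) z := by
  unfold sepMap
  fun_prop

theorem fderiv_sepMap {z : Base} (hτ : DifferentiableAt ℝ τ z.1)
    (hξ : DifferentiableAt ℝ ξ z.2.1) (hρ : DifferentiableAt ℝ ρ z.1)
    (hψ : DifferentiableAt ℝ ψ z.2.1) (v : Base) :
    fderiv ℝ (sepMap c τ ξ ρ ψ) z v = (deriv τ z.1 * v.1, deriv ξ z.2.1 * v.2.1,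
      c * v.2.2 + deriv ρ z.1 * v.1 + deriv ψ z.2.1 * v.2.1) := by
  apply fderiv_eq_of_hasDerivAt_line (differentiableAt_sepMap hτ hξ hρ hψ)
  have hu : HasDerivAt (fun s : ℝ => c * (z.2.2 + s * v.2.2)) (c * v.2.2) 0 := by
    simpa using ((((hasDerivAt_id (0 : ℝ)).mul_const v.2.2).const_add z.2.2).const_mul c)
  exact (hτ.hasDerivAt_add_smul v.1).prodMk ((hξ.hasDerivAt_add_smul v.2.1).prodMk
    ((hu.add (hρ.hasDerivAt_add_smul v.1)).add (hψ.hasDerivAt_add_smul v.2.1)))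

theorem differentiableAt_sepJet {j : Jet} (hτ : DifferentiableAt ℝ τ j.1.1)
    (hξ : DifferentiableAt ℝ ξ j.1.2.1) (hρ : DifferentiableAt ℝ ρ j.1.1)
    (hψ : DifferentiableAt ℝ ψ j.1.2.1) (hτ' : DifferentiableAt ℝ (deriv τ) j.1.1)
    (hξ' : DifferentiableAt ℝ (deriv ξ) j.1.2.1) (hρ' : DifferentiableAt ℝ (deriv ρ) j.1.1)
    (hψ' : DifferentiableAt ℝ (deriv ψ) j.1.2.1) (hτ0 : deriv τ j.1.1 ≠ 0)
    (hξ0 : deriv ξ j.1.2.1 ≠ 0) : DifferentiableAt ℝ (sepJet c τ ξ ρ ψ) j := by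
  have h0 := (differentiableAt_sepMap (c := c) hτ hξ hρ hψ).comp j differentiableAt_fst
  unfold sepJet
  refine h0.prodMk (DifferentiableAt.prodMk ?_ ?_)
  · have h1 : DifferentiableAt ℝ (fun k : Jet => deriv τ k.1.1) j :=
      hτ'.comp (f := fun k : Jet => k.1.1) j (by fun_prop)
    have h2 : DifferentiableAt ℝ (fun k : Jet => deriv ρ k.1.1) j :=
      hρ'.comp (f := fun k : Jet => k.1.1) j (by fun_prop)
    have h3 : DifferentiableAt ℝ (fun k : Jet => c * k.2.1) j := by fun_prop
    simpa only [div_eq_mul_inv] using (h3.fun_add h2).fun_mul (h1.fun_inv hτ0)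
  · have h1 : DifferentiableAt ℝ (fun k : Jet => deriv ξ k.1.2.1) j :=
      hξ'.comp (f := fun k : Jet => k.1.2.1) j (by fun_prop)
    have h2 : DifferentiableAt ℝ (fun k : Jet => deriv ψ k.1.2.1) j :=
      hψ'.comp (f := fun k : Jet => k.1.2.1) j (by fun_prop)
    have h3 : DifferentiableAt ℝ (fun k : Jet => c * k.2.2) j := by fun_prop
    simpa only [div_eq_mul_inv] using (h3.fun_add h2).fun_mul (h1.fun_inv hξ0)

theorem fderiv_sepJet {j : Jet} (hτ : DifferentiableAt ℝ τ j.1.1)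
    (hξ : DifferentiableAt ℝ ξ j.1.2.1) (hρ : DifferentiableAt ℝ ρ j.1.1)
    (hψ : DifferentiableAt ℝ ψ j.1.2.1) (hτ' : DifferentiableAt ℝ (deriv τ) j.1.1)
    (hξ' : DifferentiableAt ℝ (deriv ξ) j.1.2.1) (hρ' : DifferentiableAt ℝ (deriv ρ) j.1.1)
    (hψ' : DifferentiableAt ℝ (deriv ψ) j.1.2.1) (hτ0 : deriv τ j.1.1 ≠ 0)
    (hξ0 : deriv ξ j.1.2.1 ≠ 0) (v : Jet) :
    fderiv ℝ (sepJet c τ ξ ρ ψ) j v = (fderiv ℝ (sepMap c τ ξ ρ ψ) j.1 v.1,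
      (((c * v.2.1 + deriv (deriv ρ) j.1.1 * v.1.1) * deriv τ j.1.1 -
        (c * j.2.1 + deriv ρ j.1.1) * (deriv (deriv τ) j.1.1 * v.1.1)) / deriv τ j.1.1 ^ 2,
      ((c * v.2.2 + deriv (deriv ψ) j.1.2.1 * v.1.2.1) * deriv ξ j.1.2.1 -
        (c * j.2.2 + deriv ψ j.1.2.1) * (deriv (deriv ξ) j.1.2.1 * v.1.2.1)) /
          deriv ξ j.1.2.1 ^ 2)) := by
  apply fderiv_eq_of_hasDerivAt_line
    (differentiableAt_sepJet hτ hξ hρ hψ hτ' hξ' hρ' hψ' hτ0 hξ0)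
  have hu : ∀ a b : ℝ, HasDerivAt (fun s : ℝ => c * (a + s * b)) (c * b) 0 := by
    intro a b
    simpa using ((((hasDerivAt_id (0 : ℝ)).mul_const b).const_add a).const_mul c)
  refine ((differentiableAt_sepMap hτ hξ hρ hψ).hasFDerivAt.hasLineDerivAt v.1).prodMk
    (HasDerivAt.prodMk ?_ ?_)
  · have := ((hu j.2.1 v.2.1).add (hρ'.hasDerivAt_add_smul v.1.1)).div
      (hτ'.hasDerivAt_add_smul v.1.1) (by simpa using hτ0)
    simp only [Pi.add_apply, zero_mul, add_zero] at this
    exact this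
  · have := ((hu j.2.2 v.2.2).add (hψ'.hasDerivAt_add_smul v.1.2.1)).div
      (hξ'.hasDerivAt_add_smul v.1.2.1) (by simpa using hξ0)
    simp only [Pi.add_apply, zero_mul, add_zero] at this
    exact this

theorem totalT_eq_of_sepMap {j : Jet} (hτ : DifferentiableAt ℝ τ j.1.1)
    (hξ : DifferentiableAt ℝ ξ j.1.2.1) (hρ : DifferentiableAt ℝ ρ j.1.1)
    (hψ : DifferentiableAt ℝ ψ j.1.2.1) (hφ : φ =ᶠ[𝓝 j.1] sepMap c τ ξ ρ ψ) :
    totalT φ j = (deriv τ j.1.1, 0, c * j.2.1 + deriv ρ j.1.1) := by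
  rw [totalT, hφ.fderiv_eq, fderiv_sepMap hτ hξ hρ hψ]
  simp

theorem totalX_eq_of_sepMap {j : Jet} (hτ : DifferentiableAt ℝ τ j.1.1)
    (hξ : DifferentiableAt ℝ ξ j.1.2.1) (hρ : DifferentiableAt ℝ ρ j.1.1)
    (hψ : DifferentiableAt ℝ ψ j.1.2.1) (hφ : φ =ᶠ[𝓝 j.1] sepMap c τ ξ ρ ψ) :
    totalX φ j = (0, deriv ξ j.1.2.1, c * j.2.2 + deriv ψ j.1.2.1) := by
  rw [totalX, hφ.fderiv_eq, fderiv_sepMap hτ hξ hρ hψ]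
  simp

theorem totalJac_eq_of_sepMap {j : Jet} (hτ : DifferentiableAt ℝ τ j.1.1)
    (hξ : DifferentiableAt ℝ ξ j.1.2.1) (hρ : DifferentiableAt ℝ ρ j.1.1)
    (hψ : DifferentiableAt ℝ ψ j.1.2.1) (hφ : φ =ᶠ[𝓝 j.1] sepMap c τ ξ ρ ψ) :
    totalJac φ j = deriv τ j.1.1 * deriv ξ j.1.2.1 := by
  rw [totalJac, totalT_eq_of_sepMap hτ hξ hρ hψ hφ, totalX_eq_of_sepMap hτ hξ hρ hψ hφ]
  simp

theorem newT_eq_of_sepMap {j : Jet} (hτ : DifferentiableAt ℝ τ j.1.1)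
    (hξ : DifferentiableAt ℝ ξ j.1.2.1) (hρ : DifferentiableAt ℝ ρ j.1.1)
    (hψ : DifferentiableAt ℝ ψ j.1.2.1) (hφ : φ =ᶠ[𝓝 j.1] sepMap c τ ξ ρ ψ)
    (hξ0 : deriv ξ j.1.2.1 ≠ 0) (a b : ℝ) : newT φ j a b = a / deriv τ j.1.1 := by
  rw [newT, totalJac_eq_of_sepMap hτ hξ hρ hψ hφ, totalT_eq_of_sepMap hτ hξ hρ hψ hφ,
    totalX_eq_of_sepMap hτ hξ hρ hψ hφ]
  simp only [zero_mul, sub_zero]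
  rw [mul_comm (deriv τ j.1.1), mul_div_mul_left _ _ hξ0]

theorem newX_eq_of_sepMap {j : Jet} (hτ : DifferentiableAt ℝ τ j.1.1)
    (hξ : DifferentiableAt ℝ ξ j.1.2.1) (hρ : DifferentiableAt ℝ ρ j.1.1)
    (hψ : DifferentiableAt ℝ ψ j.1.2.1) (hφ : φ =ᶠ[𝓝 j.1] sepMap c τ ξ ρ ψ)
    (hτ0 : deriv τ j.1.1 ≠ 0) (a b : ℝ) : newX φ j a b = b / deriv ξ j.1.2.1 := by
  rw [newX, totalJac_eq_of_sepMap hτ hξ hρ hψ hφ, totalT_eq_of_sepMap hτ hξ hρ hψ hφ,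
    totalX_eq_of_sepMap hτ hξ hρ hψ hφ]
  simp only [zero_mul, sub_zero]
  rw [mul_div_mul_left _ _ hτ0]

/-- The functions in `sepMap` are twice differentiable, with `τ'` and `ξ'` nonzero, at the points
given by a jet. -/
structure SepRegular (τ ξ ρ ψ : ℝ → ℝ) (j : Jet) : Prop where
  τ₁ : DifferentiableAt ℝ τ j.1.1
  ξ₁ : DifferentiableAt ℝ ξ j.1.2.1
  ρ₁ : DifferentiableAt ℝ ρ j.1.1
  ψ₁ : DifferentiableAt ℝ ψ j.1.2.1
  τ₂ : DifferentiableAt ℝ (deriv τ) j.1.1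
  ξ₂ : DifferentiableAt ℝ (deriv ξ) j.1.2.1
  ρ₂ : DifferentiableAt ℝ (deriv ρ) j.1.1
  ψ₂ : DifferentiableAt ℝ (deriv ψ) j.1.2.1
  τ_ne : deriv τ j.1.1 ≠ 0
  ξ_ne : deriv ξ j.1.2.1 ≠ 0

theorem SepRegular.newTT_eq {j : Jet} (h : SepRegular τ ξ ρ ψ j)
    (hφ : φ =ᶠ[𝓝 j.1] sepMap c τ ξ ρ ψ) (hφ₁ : φ₁ =ᶠ[𝓝 j] sepJet c τ ξ ρ ψ) (r s q : ℝ) :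
    newTT φ φ₁ j r s q = (c * r + deriv (deriv ρ) j.1.1 -
      deriv (deriv τ) j.1.1 * ((c * j.2.1 + deriv ρ j.1.1) / deriv τ j.1.1)) /
        deriv τ j.1.1 ^ 2 := by
  have h0 := h.τ_ne
  rw [newTT, newT_eq_of_sepMap h.τ₁ h.ξ₁ h.ρ₁ h.ψ₁ hφ h.ξ_ne, totalT', hφ₁.fderiv_eq,
    fderiv_sepJet h.τ₁ h.ξ₁ h.ρ₁ h.ψ₁ h.τ₂ h.ξ₂ h.ρ₂ h.ψ₂ h.τ_ne h.ξ_ne]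
  simp only [mul_one]
  field_simp

theorem SepRegular.newXX_eq {j : Jet} (h : SepRegular τ ξ ρ ψ j)
    (hφ : φ =ᶠ[𝓝 j.1] sepMap c τ ξ ρ ψ) (hφ₁ : φ₁ =ᶠ[𝓝 j] sepJet c τ ξ ρ ψ) (r s q : ℝ) :
    newXX φ φ₁ j r s q = (c * q + deriv (deriv ψ) j.1.2.1 -
      deriv (deriv ξ) j.1.2.1 * ((c * j.2.2 + deriv ψ j.1.2.1) / deriv ξ j.1.2.1)) /
        deriv ξ j.1.2.1 ^ 2 := by
  have h0 := h.ξ_ne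
  rw [newXX, newX_eq_of_sepMap h.τ₁ h.ξ₁ h.ρ₁ h.ψ₁ hφ h.τ_ne, totalX', hφ₁.fderiv_eq,
    fderiv_sepJet h.τ₁ h.ξ₁ h.ρ₁ h.ψ₁ h.τ₂ h.ξ₂ h.ρ₂ h.ψ₂ h.τ_ne h.ξ_ne]
  simp only [mul_one]
  field_simp

end

/-! ### Local separation of variables -/

theorem eq_of_hasDerivAt_zero_on_ball {f : ℝ → ℝ} {x₀ ε : ℝ}
    (hf : ∀ x ∈ Metric.ball x₀ ε, HasDerivAt f 0 x) {x y : ℝ} (hx : x ∈ Metric.ball x₀ ε)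
    (hy : y ∈ Metric.ball x₀ ε) : f x = f y :=
  Metric.isOpen_ball.is_const_of_deriv_eq_zero (convex_ball x₀ ε).isPreconnected
    (fun z hz => (hf z hz).differentiableAt.differentiableWithinAt) (fun z hz => (hf z hz).deriv)
    hx hy

theorem _root_.HasDerivAt.prod_fst {E G : Type*} [NormedAddCommGroup E] [NormedSpace ℝ E]
    [NormedAddCommGroup G] [NormedSpace ℝ G] {f : ℝ → E × G} {d : E × G} {x : ℝ}
    (h : HasDerivAt f d x) : HasDerivAt (fun y => (f y).1) d.1 x :=
  (hasFDerivAt_fst (𝕜 := ℝ) (p := f x)).comp_hasDerivAt x h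

theorem _root_.HasDerivAt.prod_snd {E G : Type*} [NormedAddCommGroup E] [NormedSpace ℝ E]
    [NormedAddCommGroup G] [NormedSpace ℝ G] {f : ℝ → E × G} {d : E × G} {x : ℝ}
    (h : HasDerivAt f d x) : HasDerivAt (fun y => (f y).2) d.2 x :=
  (hasFDerivAt_snd (𝕜 := ℝ) (p := f x)).comp_hasDerivAt x h

section

variable {Φ : Ext → Ext} {M : Set Ext} {φ : Base → Base} {φ₁ : Jet → Jet}

theorem hasDerivAt_t_of_differentiableAt {t x u : ℝ} (h : DifferentiableAt ℝ φ (t, x, u)) :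
    HasDerivAt (fun t => φ (t, x, u)) (fderiv ℝ φ (t, x, u) (1, 0, 0)) t :=
  h.hasFDerivAt.comp_hasDerivAt t ((hasDerivAt_id t).prodMk (hasDerivAt_const t (x, u)))

theorem hasDerivAt_x_of_differentiableAt {t x u : ℝ} (h : DifferentiableAt ℝ φ (t, x, u)) :
    HasDerivAt (fun x => φ (t, x, u)) (fderiv ℝ φ (t, x, u) (0, 1, 0)) x :=
  h.hasFDerivAt.comp_hasDerivAt x
    ((hasDerivAt_const x t).prodMk ((hasDerivAt_id x).prodMk (hasDerivAt_const x u)))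

theorem hasDerivAt_u_of_differentiableAt {t x u : ℝ} (h : DifferentiableAt ℝ φ (t, x, u)) :
    HasDerivAt (fun u => φ (t, x, u)) (fderiv ℝ φ (t, x, u) (0, 0, 1)) u :=
  h.hasFDerivAt.comp_hasDerivAt u
    ((hasDerivAt_const u t).prodMk ((hasDerivAt_const u x).prodMk (hasDerivAt_id u)))

/-- On a box, `φ` separates: `T_x = T_u = X_t = X_u = 0`, and since `U_x + u_x U_u` depends on
`(x, u_x)` only, so do `U_x` and `U_u` on `x`, which makes `U` a sum of functions of one variable,
affine in `u`. -/
theorem IsPointwiseEquivalence.exists_eq_sepMap (h : IsPointwiseEquivalence Φ M φ φ₁)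
    {t₀ x₀ u₀ a₀ b₀ ε : ℝ} (hε : 0 < ε)
    (hbox : ∀ t ∈ Metric.ball t₀ ε, ∀ x ∈ Metric.ball x₀ ε, ∀ u ∈ Metric.ball u₀ ε,
      ∀ a ∈ Metric.ball a₀ ε, ∀ b ∈ Metric.ball b₀ ε, ((t, x, u), (a, b)) ∈ jetDomain M) :
    ∃ (c : ℝ) (τ ξ ρ ψ : ℝ → ℝ), ContDiffOn ℝ ∞ τ (Metric.ball t₀ ε) ∧
      ContDiffOn ℝ ∞ ξ (Metric.ball x₀ ε) ∧ ContDiffOn ℝ ∞ ρ (Metric.ball t₀ ε) ∧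
      ContDiffOn ℝ ∞ ψ (Metric.ball x₀ ε) ∧
      ∀ t ∈ Metric.ball t₀ ε, ∀ x ∈ Metric.ball x₀ ε, ∀ u ∈ Metric.ball u₀ ε,
        φ (t, x, u) = sepMap c τ ξ ρ ψ (t, x, u) := by
  have ht₀ : t₀ ∈ Metric.ball t₀ ε := Metric.mem_ball_self hε
  have hx₀ : x₀ ∈ Metric.ball x₀ ε := Metric.mem_ball_self hε
  have hu₀ : u₀ ∈ Metric.ball u₀ ε := Metric.mem_ball_self hε
  have ha₀ : a₀ ∈ Metric.ball a₀ ε := Metric.mem_ball_self hε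
  have hb₀ : b₀ ∈ Metric.ball b₀ ε := Metric.mem_ball_self hε
  have hD : ∀ t ∈ Metric.ball t₀ ε, ∀ x ∈ Metric.ball x₀ ε, ∀ u ∈ Metric.ball u₀ ε,
      ((t, x, u) : Base) ∈ baseDomain M := fun t ht x hx u hu =>
    ⟨((t, x, u), (a₀, b₀)), hbox t ht x hx u hu a₀ ha₀ b₀ hb₀, rfl⟩
  have hd : ∀ t ∈ Metric.ball t₀ ε, ∀ x ∈ Metric.ball x₀ ε, ∀ u ∈ Metric.ball u₀ ε,
      DifferentiableAt ℝ φ (t, x, u) := fun t ht x hx u hu =>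
    h.differentiableAt (hD t ht x hx u hu)
  have hT : ∀ t ∈ Metric.ball t₀ ε, ∀ x ∈ Metric.ball x₀ ε, ∀ u ∈ Metric.ball u₀ ε,
      (φ (t, x, u)).1 = (φ (t, x₀, u₀)).1 := by
    intro t ht x hx u hu
    have h1 : (φ (t, x, u)).1 = (φ (t, x₀, u)).1 :=
      eq_of_hasDerivAt_zero_on_ball (f := fun x => (φ (t, x, u)).1) (fun y hy => by
        have := (hasDerivAt_x_of_differentiableAt (hd t ht y hy u hu)).prod_fst
        rwa [h.fderiv_t_eq_zero (hD t ht y hy u hu)] at this) hx hx₀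
    rw [h1]
    exact eq_of_hasDerivAt_zero_on_ball (f := fun u => (φ (t, x₀, u)).1) (fun y hy => by
        have := (hasDerivAt_u_of_differentiableAt (hd t ht x₀ hx₀ y hy)).prod_fst
        rwa [h.fderiv_t_eq_zero (hD t ht x₀ hx₀ y hy)] at this) hu hu₀
  have hX : ∀ t ∈ Metric.ball t₀ ε, ∀ x ∈ Metric.ball x₀ ε, ∀ u ∈ Metric.ball u₀ ε,
      (φ (t, x, u)).2.1 = (φ (t₀, x, u₀)).2.1 := by
    intro t ht x hx u hu
    have h1 : (φ (t, x, u)).2.1 = (φ (t₀, x, u)).2.1 :=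
      eq_of_hasDerivAt_zero_on_ball (f := fun t => (φ (t, x, u)).2.1) (fun y hy => by
        have := (hasDerivAt_t_of_differentiableAt (hd y hy x hx u hu)).prod_snd.prod_fst
        rwa [h.fderiv_x_eq_zero (hD y hy x hx u hu)] at this) ht ht₀
    rw [h1]
    exact eq_of_hasDerivAt_zero_on_ball (f := fun u => (φ (t₀, x, u)).2.1) (fun y hy => by
        have := (hasDerivAt_u_of_differentiableAt (hd t₀ ht₀ x hx y hy)).prod_snd.prod_fst
        rwa [h.fderiv_x_eq_zero (hD t₀ ht₀ x hx y hy)] at this) hu hu₀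
  have hXx : ∀ t ∈ Metric.ball t₀ ε, ∀ x ∈ Metric.ball x₀ ε, ∀ u ∈ Metric.ball u₀ ε,
      (fderiv ℝ φ (t, x, u) (0, 1, 0)).2.1 = (fderiv ℝ φ (t₀, x, u₀) (0, 1, 0)).2.1 := by
    intro t ht x hx u hu
    have h1 := (hasDerivAt_x_of_differentiableAt (hd t ht x hx u hu)).prod_snd.prod_fst
    have h2 := (hasDerivAt_x_of_differentiableAt (hd t₀ ht₀ x hx u₀ hu₀)).prod_snd.prod_fst
    refine h1.unique (h2.congr_of_eventuallyEq ?_)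
    filter_upwards [Metric.isOpen_ball.mem_nhds hx] with y hy
    exact hX t ht y hy u hu
  -- `ũ_x̃` depends on `(x, u_x)` only
  have hQ : ∀ t ∈ Metric.ball t₀ ε, ∀ x ∈ Metric.ball x₀ ε, ∀ u ∈ Metric.ball u₀ ε,
      ∀ b ∈ Metric.ball b₀ ε,
      (φ₁ ((t, x, u), (a₀, b))).2.2 = (φ₁ ((t₀, x, u₀), (a₀, b))).2.2 := by
    intro t ht x hx u hu b hb
    have hj := fun t ht u hu => h.differentiableAt_jet (hbox t ht x hx u hu a₀ ha₀ b hb)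
    have h1 : (φ₁ ((t, x, u), (a₀, b))).2.2 = (φ₁ ((t₀, x, u), (a₀, b))).2.2 :=
      eq_of_hasDerivAt_zero_on_ball (f := fun t => (φ₁ ((t, x, u), (a₀, b))).2.2) (fun y hy => by
        have := (HasFDerivAt.comp_hasDerivAt (f := fun t : ℝ => (((t, x, u), (a₀, b)) : Jet)) y
          (hj y hy u hu).hasFDerivAt (((hasDerivAt_id y).prodMk (hasDerivAt_const y (x, u))).prodMk
            (hasDerivAt_const y (a₀, b)))).prod_snd.prod_snd
        have h0 := congrArg Prod.snd (h.arg_fderiv (hbox y hy x hx u hu a₀ ha₀ b hb)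
          (v := ((1, 0), (0, 0))) rfl)
        exact this.congr_deriv h0) ht ht₀
    rw [h1]
    exact eq_of_hasDerivAt_zero_on_ball (f := fun u => (φ₁ ((t₀, x, u), (a₀, b))).2.2)
      (fun y hy => by
        have := (HasFDerivAt.comp_hasDerivAt (f := fun u : ℝ => (((t₀, x, u), (a₀, b)) : Jet)) y
          (hj t₀ ht₀ y hy).hasFDerivAt (((hasDerivAt_const y t₀).prodMk ((hasDerivAt_const y x).prodMk
            (hasDerivAt_id y))).prodMk (hasDerivAt_const y (a₀, b)))).prod_snd.prod_snd
        have h0 := congrArg Prod.snd (h.arg_fderiv (hbox t₀ ht₀ x hx y hy a₀ ha₀ b hb)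
          (v := ((0, 0, 1), (0, 0))) rfl)
        exact this.congr_deriv h0) hu hu₀
  have hU : ∀ t ∈ Metric.ball t₀ ε, ∀ x ∈ Metric.ball x₀ ε, ∀ u ∈ Metric.ball u₀ ε,
      (fderiv ℝ φ (t, x, u) (0, 1, 0)).2.2 = (fderiv ℝ φ (t₀, x, u₀) (0, 1, 0)).2.2 ∧
      (fderiv ℝ φ (t, x, u) (0, 0, 1)).2.2 = (fderiv ℝ φ (t₀, x, u₀) (0, 0, 1)).2.2 := by
    intro t ht x hx u hu
    have hb : ∀ b ∈ Metric.ball b₀ ε, (fderiv ℝ φ (t, x, u) (0, 1, 0)).2.2 +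
        b * (fderiv ℝ φ (t, x, u) (0, 0, 1)).2.2 = (fderiv ℝ φ (t₀, x, u₀) (0, 1, 0)).2.2 +
        b * (fderiv ℝ φ (t₀, x, u₀) (0, 0, 1)).2.2 := by
      intro b hb
      have h1 := h.fderiv_u_eq (hbox t ht x hx u hu a₀ ha₀ b hb)
      have h2 := h.fderiv_u_eq (hbox t₀ ht₀ x hx u₀ hu₀ a₀ ha₀ b hb)
      simp only at h1 h2
      rw [hQ t ht x hx u hu b hb, hXx t ht x hx u hu, ← h2] at h1
      have e : ((0, 1, b) : Base) = (0, 1, 0) + b • (0, 0, 1) := by simp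
      rw [e, map_add, map_smul, map_add, map_smul] at h1
      simpa using h1
    -- equality at two values of `u_x` separates `U_x` from `U_u`
    have hb₁ : b₀ + ε / 2 ∈ Metric.ball b₀ ε := by
      rw [Metric.mem_ball, Real.dist_eq, add_sub_cancel_left, abs_of_pos (by positivity)]
      linarith
    have e₀ := hb b₀ hb₀
    have e₁ := hb _ hb₁
    have e₂ : (fderiv ℝ φ (t, x, u) (0, 0, 1)).2.2 = (fderiv ℝ φ (t₀, x, u₀) (0, 0, 1)).2.2 := by
      have : (ε / 2) * ((fderiv ℝ φ (t, x, u) (0, 0, 1)).2.2 -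
        (fderiv ℝ φ (t₀, x, u₀) (0, 0, 1)).2.2) = 0 := by linear_combination e₁ - e₀
      rcases mul_eq_zero.1 this with h0 | h0
      · linarith
      · linarith
    exact ⟨by rw [e₂] at e₀; linarith, e₂⟩
  have hU₁ : ∀ t ∈ Metric.ball t₀ ε, ∀ x ∈ Metric.ball x₀ ε, ∀ u ∈ Metric.ball u₀ ε,
      (φ (t, x, u)).2.2 - (φ (t₀, x, u₀)).2.2 = (φ (t, x₀, u)).2.2 - (φ (t₀, x₀, u₀)).2.2 := by
    intro t ht x hx u hu
    exact eq_of_hasDerivAt_zero_on_ball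
      (f := fun x => (φ (t, x, u)).2.2 - (φ (t₀, x, u₀)).2.2) (fun y hy => by
        have := (hasDerivAt_x_of_differentiableAt (hd t ht y hy u hu)).prod_snd.prod_snd.sub
          (hasDerivAt_x_of_differentiableAt (hd t₀ ht₀ y hy u₀ hu₀)).prod_snd.prod_snd
        rwa [(hU t ht y hy u hu).1, sub_self] at this) hx hx₀
  have hU₂ : ∀ t ∈ Metric.ball t₀ ε, ∀ u ∈ Metric.ball u₀ ε,
      (φ (t, x₀, u)).2.2 - (fderiv ℝ φ (t₀, x₀, u₀) (0, 0, 1)).2.2 * u =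
      (φ (t, x₀, u₀)).2.2 - (fderiv ℝ φ (t₀, x₀, u₀) (0, 0, 1)).2.2 * u₀ := by
    intro t ht u hu
    exact eq_of_hasDerivAt_zero_on_ball
      (f := fun u => (φ (t, x₀, u)).2.2 - (fderiv ℝ φ (t₀, x₀, u₀) (0, 0, 1)).2.2 * u)
      (fun y hy => by
        have := (hasDerivAt_u_of_differentiableAt (hd t ht x₀ hx₀ y hy)).prod_snd.prod_snd.sub
          ((hasDerivAt_id y).const_mul (fderiv ℝ φ (t₀, x₀, u₀) (0, 0, 1)).2.2)
        rwa [(hU t ht x₀ hx₀ y hy).2, mul_one, sub_self] at this) hu hu₀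
  have hst : ContDiffOn ℝ ∞ (fun t => φ (t, x₀, u₀)) (Metric.ball t₀ ε) :=
    h.base.smooth.comp (contDiff_id.prodMk contDiff_const).contDiffOn
      (fun t ht => hD t ht x₀ hx₀ u₀ hu₀)
  have hsx : ContDiffOn ℝ ∞ (fun x => φ (t₀, x, u₀)) (Metric.ball x₀ ε) :=
    h.base.smooth.comp (contDiff_const.prodMk (contDiff_id.prodMk contDiff_const)).contDiffOn
      (fun x hx => hD t₀ ht₀ x hx u₀ hu₀)
  refine ⟨(fderiv ℝ φ (t₀, x₀, u₀) (0, 0, 1)).2.2, fun t => (φ (t, x₀, u₀)).1,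
    fun x => (φ (t₀, x, u₀)).2.1, fun t => (φ (t, x₀, u₀)).2.2,
    fun x => (φ (t₀, x, u₀)).2.2 - (φ (t₀, x₀, u₀)).2.2 -
      (fderiv ℝ φ (t₀, x₀, u₀) (0, 0, 1)).2.2 * u₀, hst.fst, hsx.snd.fst, hst.snd.snd,
    (hsx.snd.snd.sub contDiffOn_const).sub contDiffOn_const, ?_⟩
  intro t ht x hx u hu
  refine Prod.ext (hT t ht x hx u hu) (Prod.ext (hX t ht x hx u hu) ?_)
  have e₁ := hU₁ t ht x hx u hu
  have e₂ := hU₂ t ht u hu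
  simp only [sepMap]
  linear_combination e₁ + e₂

end

/-! ### The explicit form near a point -/

theorem _root_.ContDiffOn.deriv_infty {f : ℝ → ℝ} {s : Set ℝ} (hf : ContDiffOn ℝ ∞ f s)
    (hs : IsOpen s) : ContDiffOn ℝ ∞ (deriv f) s :=
  hf.deriv_of_isOpen hs (by simp)

theorem _root_.ContDiffOn.differentiableAt_of_isOpen {f : ℝ → ℝ} {s : Set ℝ}
    (hf : ContDiffOn ℝ ∞ f s) (hs : IsOpen s) {x : ℝ} (hx : x ∈ s) : DifferentiableAt ℝ f x :=
  (hf.contDiffAt (hs.mem_nhds hx)).differentiableAt (by simp)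

theorem SepRegular.of_contDiffOn {τ ξ ρ ψ : ℝ → ℝ} {s t : Set ℝ} (hs : IsOpen s) (ht : IsOpen t)
    (hτ : ContDiffOn ℝ ∞ τ t) (hξ : ContDiffOn ℝ ∞ ξ s) (hρ : ContDiffOn ℝ ∞ ρ t)
    (hψ : ContDiffOn ℝ ∞ ψ s) {j : Jet} (hjt : j.1.1 ∈ t) (hjs : j.1.2.1 ∈ s)
    (hτ0 : deriv τ j.1.1 ≠ 0) (hξ0 : deriv ξ j.1.2.1 ≠ 0) : SepRegular τ ξ ρ ψ j :=
  ⟨hτ.differentiableAt_of_isOpen ht hjt, hξ.differentiableAt_of_isOpen hs hjs,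
    hρ.differentiableAt_of_isOpen ht hjt, hψ.differentiableAt_of_isOpen hs hjs,
    (hτ.deriv_infty ht).differentiableAt_of_isOpen ht hjt,
    (hξ.deriv_infty hs).differentiableAt_of_isOpen hs hjs,
    (hρ.deriv_infty ht).differentiableAt_of_isOpen ht hjt,
    (hψ.deriv_infty hs).differentiableAt_of_isOpen hs hjs, hτ0, hξ0⟩

/-- Comparison of coefficients in `u_tt = f u_xx + g` and its image. -/
theorem eq_of_equation_iff {c A B f g f' g' a b : ℝ} (hc : c ≠ 0) (ha : a ≠ 0) (hb : b ≠ 0)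
    (h : ∀ r q : ℝ, r = f * q + g ↔ (c * r + A) / a ^ 2 = f' * ((c * q + B) / b ^ 2) + g') :
    f' = b ^ 2 / a ^ 2 * f ∧ g' = (c * g + A) / a ^ 2 - f / a ^ 2 * B := by
  have h0 := (h (f * 0 + g) 0).1 rfl
  have h1 := (h (f * 1 + g) 1).1 rfl
  have hf : f' = b ^ 2 / a ^ 2 * f := by
    field_simp at h0 h1 ⊢
    have : c * (b ^ 2 * f - f' * a ^ 2) = 0 := by linear_combination h1 - h0
    rcases mul_eq_zero.1 this with h2 | h2
    · exact absurd h2 hc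
    · linarith
  refine ⟨hf, ?_⟩
  rw [hf] at h0
  field_simp at h0 ⊢
  linarith

theorem mem_ball_ext {t x u a b f g t₀ x₀ u₀ a₀ b₀ f₀ g₀ ε : ℝ} :
    ((((t, x, u), (a, b)), (f, g)) : Ext) ∈ Metric.ball (((t₀, x₀, u₀), (a₀, b₀)), (f₀, g₀)) ε ↔
      ((t ∈ Metric.ball t₀ ε ∧ x ∈ Metric.ball x₀ ε ∧ u ∈ Metric.ball u₀ ε) ∧
        a ∈ Metric.ball a₀ ε ∧ b ∈ Metric.ball b₀ ε) ∧
        f ∈ Metric.ball f₀ ε ∧ g ∈ Metric.ball g₀ ε := by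
  simp only [← ball_prod_same, mem_prod]

/-- Near each point of its domain, an equivalence transformation has the explicit form. -/
theorem IsPointwiseEquivalence.exists_explicitForm {Φ : Ext → Ext} {M : Set Ext} {φ : Base → Base}
    {φ₁ : Jet → Jet} (h : IsPointwiseEquivalence Φ M φ φ₁) {m : Ext} (hm : m ∈ M) :
    ∃ N ⊆ M, IsOpen N ∧ m ∈ N ∧ HasExplicitForm Φ N := by
  obtain ⟨ε, hε, hball⟩ := Metric.isOpen_iff.1 h.isOpen m hm
  refine ⟨Metric.ball m ε, hball, Metric.isOpen_ball, Metric.mem_ball_self hε, ?_⟩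
  obtain ⟨⟨⟨t₀, x₀, u₀⟩, a₀, b₀⟩, f₀, g₀⟩ := m
  have ht₀ : t₀ ∈ Metric.ball t₀ ε := Metric.mem_ball_self hε
  have hx₀ : x₀ ∈ Metric.ball x₀ ε := Metric.mem_ball_self hε
  have hu₀ : u₀ ∈ Metric.ball u₀ ε := Metric.mem_ball_self hε
  have ha₀ : a₀ ∈ Metric.ball a₀ ε := Metric.mem_ball_self hε
  have hb₀ : b₀ ∈ Metric.ball b₀ ε := Metric.mem_ball_self hε
  have hf₀ : f₀ ∈ Metric.ball f₀ ε := Metric.mem_ball_self hε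
  have hg₀ : g₀ ∈ Metric.ball g₀ ε := Metric.mem_ball_self hε
  have hM : ∀ t ∈ Metric.ball t₀ ε, ∀ x ∈ Metric.ball x₀ ε, ∀ u ∈ Metric.ball u₀ ε,
      ∀ a ∈ Metric.ball a₀ ε, ∀ b ∈ Metric.ball b₀ ε, ∀ f ∈ Metric.ball f₀ ε,
      ∀ g ∈ Metric.ball g₀ ε, (((t, x, u), (a, b)), (f, g)) ∈ M :=
    fun t ht x hx u hu a ha b hb f hf g hg =>
      hball (mem_ball_ext.2 ⟨⟨⟨ht, hx, hu⟩, ha, hb⟩, hf, hg⟩)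
  have hbox : ∀ t ∈ Metric.ball t₀ ε, ∀ x ∈ Metric.ball x₀ ε, ∀ u ∈ Metric.ball u₀ ε,
      ∀ a ∈ Metric.ball a₀ ε, ∀ b ∈ Metric.ball b₀ ε, ((t, x, u), (a, b)) ∈ jetDomain M :=
    fun t ht x hx u hu a ha b hb => ⟨_, hM t ht x hx u hu a ha b hb f₀ hf₀ g₀ hg₀, rfl⟩
  obtain ⟨c, τ, ξ, ρ, ψ, hτ, hξ, hρ, hψ, hsep⟩ := h.exists_eq_sepMap hε hbox
  have hφ : ∀ t ∈ Metric.ball t₀ ε, ∀ x ∈ Metric.ball x₀ ε, ∀ u ∈ Metric.ball u₀ ε,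
      φ =ᶠ[𝓝 (t, x, u)] sepMap c τ ξ ρ ψ := by
    intro t ht x hx u hu
    filter_upwards [prod_mem_nhds (Metric.isOpen_ball.mem_nhds ht)
      (prod_mem_nhds (Metric.isOpen_ball.mem_nhds hx) (Metric.isOpen_ball.mem_nhds hu))]
      with z hz
    exact hsep _ hz.1 _ hz.2.1 _ hz.2.2
  have dτ : ∀ t ∈ Metric.ball t₀ ε, DifferentiableAt ℝ τ t := fun t ht =>
    hτ.differentiableAt_of_isOpen Metric.isOpen_ball ht
  have dξ : ∀ x ∈ Metric.ball x₀ ε, DifferentiableAt ℝ ξ x := fun x hx =>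
    hξ.differentiableAt_of_isOpen Metric.isOpen_ball hx
  have dρ : ∀ t ∈ Metric.ball t₀ ε, DifferentiableAt ℝ ρ t := fun t ht =>
    hρ.differentiableAt_of_isOpen Metric.isOpen_ball ht
  have dψ : ∀ x ∈ Metric.ball x₀ ε, DifferentiableAt ℝ ψ x := fun x hx =>
    hψ.differentiableAt_of_isOpen Metric.isOpen_ball hx
  have dτ' : ∀ t ∈ Metric.ball t₀ ε, DifferentiableAt ℝ (deriv τ) t := fun t ht =>
    (hτ.deriv_infty Metric.isOpen_ball).differentiableAt_of_isOpen Metric.isOpen_ball ht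
  have dρ' : ∀ t ∈ Metric.ball t₀ ε, DifferentiableAt ℝ (deriv ρ) t := fun t ht =>
    (hρ.deriv_infty Metric.isOpen_ball).differentiableAt_of_isOpen Metric.isOpen_ball ht
  have hne : ∀ t ∈ Metric.ball t₀ ε, ∀ x ∈ Metric.ball x₀ ε, deriv τ t ≠ 0 ∧ deriv ξ x ≠ 0 := by
    intro t ht x hx
    have h1 := (h.prolongation _ (hbox t ht x hx u₀ hu₀ a₀ ha₀ b₀ hb₀)).1
    rw [totalJac_eq_of_sepMap (dτ t ht) (dξ x hx) (dρ t ht) (dψ x hx) (hφ t ht x hx u₀ hu₀)] at h1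
    exact mul_ne_zero_iff.1 h1
  have hc : c ≠ 0 := by
    -- otherwise `∂φ / ∂u = 0` at the centre of the box
    intro hc
    have hz : ((t₀, x₀, u₀) : Base) ∈ baseDomain M :=
      ⟨_, hbox t₀ ht₀ x₀ hx₀ u₀ hu₀ a₀ ha₀ b₀ hb₀, rfl⟩
    have h1 : fderiv ℝ φ (t₀, x₀, u₀) (0, 0, 1) = fderiv ℝ φ (t₀, x₀, u₀) 0 := by
      rw [(hφ t₀ ht₀ x₀ hx₀ u₀ hu₀).fderiv_eq,
        fderiv_sepMap (dτ _ ht₀) (dξ _ hx₀) (dρ _ ht₀) (dψ _ hx₀), hc]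
      simp
    have h2 := (h.base.nondegenerate _ hz).1 h1
    simp at h2
  have hjet : ∀ t ∈ Metric.ball t₀ ε, ∀ x ∈ Metric.ball x₀ ε, ∀ u ∈ Metric.ball u₀ ε,
      ∀ a ∈ Metric.ball a₀ ε, ∀ b ∈ Metric.ball b₀ ε,
      φ₁ ((t, x, u), (a, b)) = sepJet c τ ξ ρ ψ ((t, x, u), (a, b)) := by
    intro t ht x hx u hu a ha b hb
    rw [(h.prolongation _ (hbox t ht x hx u hu a ha b hb)).2, sepJet,
      newT_eq_of_sepMap (dτ t ht) (dξ x hx) (dρ t ht) (dψ x hx) (hφ t ht x hx u hu)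
        (hne t ht x hx).2,
      newX_eq_of_sepMap (dτ t ht) (dξ x hx) (dρ t ht) (dψ x hx) (hφ t ht x hx u hu)
        (hne t ht x hx).1,
      totalT_eq_of_sepMap (dτ t ht) (dξ x hx) (dρ t ht) (dψ x hx) (hφ t ht x hx u hu),
      totalX_eq_of_sepMap (dτ t ht) (dξ x hx) (dρ t ht) (dψ x hx) (hφ t ht x hx u hu)]
    exact Prod.ext (hsep t ht x hx u hu) rfl
  -- the components `f̃` and `g̃`, from the coefficients of the image equation
  have hcoef : ∀ t ∈ Metric.ball t₀ ε, ∀ x ∈ Metric.ball x₀ ε, ∀ u ∈ Metric.ball u₀ ε,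
      ∀ a ∈ Metric.ball a₀ ε, ∀ b ∈ Metric.ball b₀ ε, ∀ f ∈ Metric.ball f₀ ε,
      ∀ g ∈ Metric.ball g₀ ε,
      (Φ (((t, x, u), (a, b)), (f, g))).2.1 = deriv ξ x ^ 2 / deriv τ t ^ 2 * f ∧
      (Φ (((t, x, u), (a, b)), (f, g))).2.2 = (c * g + (deriv (deriv ρ) t -
        deriv (deriv τ) t * ((c * a + deriv ρ t) / deriv τ t))) / deriv τ t ^ 2 -
        f / deriv τ t ^ 2 * (deriv (deriv ψ) x -
          deriv (deriv ξ) x * ((c * b + deriv ψ x) / deriv ξ x)) := by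
    intro t ht x hx u hu a ha b hb f hf g hg
    have hreg : SepRegular τ ξ ρ ψ ((t, x, u), (a, b)) :=
      .of_contDiffOn Metric.isOpen_ball Metric.isOpen_ball hτ hξ hρ hψ ht hx (hne t ht x hx).1
        (hne t ht x hx).2
    have hφ₁ : φ₁ =ᶠ[𝓝 ((t, x, u), (a, b))] sepJet c τ ξ ρ ψ := by
      filter_upwards [prod_mem_nhds (prod_mem_nhds (Metric.isOpen_ball.mem_nhds ht)
        (prod_mem_nhds (Metric.isOpen_ball.mem_nhds hx) (Metric.isOpen_ball.mem_nhds hu)))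
        (prod_mem_nhds (Metric.isOpen_ball.mem_nhds ha) (Metric.isOpen_ball.mem_nhds hb))]
        with j hj
      exact hjet _ hj.1.1 _ hj.1.2.1 _ hj.1.2.2 _ hj.2.1 _ hj.2.2
    apply eq_of_equation_iff hc (hne t ht x hx).1 (hne t ht x hx).2
    intro r q
    have h1 := h.equation _ (hM t ht x hx u hu a ha b hb f hf g hg) r 0 q
    rw [hreg.newTT_eq (hφ t ht x hx u hu) hφ₁, hreg.newXX_eq (hφ t ht x hx u hu) hφ₁] at h1
    simp only [add_sub_assoc] at h1
    exact h1
  have hgraph : ∀ t ∈ Metric.ball t₀ ε, ∀ f ∈ Metric.ball f₀ ε,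
      (Φ (((t, x₀, u₀), (a₀, b₀)), (f, g₀))).2 = (Φ (((t₀, x₀, u₀), (a₀, b₀)), (f, g₀))).2 := by
    intro t ht f hf
    apply h.graph _ (hM t ht x₀ hx₀ u₀ hu₀ a₀ ha₀ b₀ hb₀ f hf g₀ hg₀) _
      (hM t₀ ht₀ x₀ hx₀ u₀ hu₀ a₀ ha₀ b₀ hb₀ f hf g₀ hg₀) (fun _ => rfl)
    rw [hjet t ht x₀ hx₀ u₀ hu₀ a₀ ha₀ b₀ hb₀, hjet t₀ ht₀ x₀ hx₀ u₀ hu₀ a₀ ha₀ b₀ hb₀]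
    rfl
  have hτ2 : ∀ t ∈ Metric.ball t₀ ε, deriv τ t ^ 2 = deriv τ t₀ ^ 2 := by
    -- The new coefficient `f̃` does not depend on `t`; it is compared where `f ≠ 0`.
    obtain ⟨f, hf, hf0⟩ : ∃ f ∈ Metric.ball f₀ ε, f ≠ 0 := by
      by_cases h0 : f₀ = 0
      · refine ⟨ε / 2, ?_, by positivity⟩
        rw [h0, Metric.mem_ball, Real.dist_eq, sub_zero, abs_of_pos (by positivity)]
        linarith
      · exact ⟨f₀, hf₀, h0⟩
    intro t ht
    have h1 := congrArg Prod.fst (hgraph t ht f hf)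
    rw [(hcoef t ht x₀ hx₀ u₀ hu₀ a₀ ha₀ b₀ hb₀ f hf g₀ hg₀).1,
      (hcoef t₀ ht₀ x₀ hx₀ u₀ hu₀ a₀ ha₀ b₀ hb₀ f hf g₀ hg₀).1] at h1
    have n1 := (hne t ht x₀ hx₀).1
    have n2 := (hne t₀ ht₀ x₀ hx₀).1
    have n3 := (hne t₀ ht₀ x₀ hx₀).2
    field_simp at h1
    exact h1.symm
  have hτ'' : ∀ t ∈ Metric.ball t₀ ε, deriv (deriv τ) t = 0 := by
    intro t ht
    have h1 := (dτ' t ht).hasDerivAt.pow 2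
    have h2 : deriv τ ^ 2 =ᶠ[𝓝 t] fun _ => deriv τ t₀ ^ 2 := by
      filter_upwards [Metric.isOpen_ball.mem_nhds ht] with s hs
      exact hτ2 s hs
    have h3 := h1.unique ((hasDerivAt_const t _).congr_of_eventuallyEq h2)
    simpa [(hne t ht x₀ hx₀).1] using h3
  have hτ' : ∀ t ∈ Metric.ball t₀ ε, deriv τ t = deriv τ t₀ := fun t ht =>
    eq_of_hasDerivAt_zero_on_ball (fun s hs => hτ'' s hs ▸ (dτ' s hs).hasDerivAt) ht ht₀
  -- likewise `g̃` does not depend on `t`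
  have hρ'' : ∀ t ∈ Metric.ball t₀ ε, deriv (deriv ρ) t = deriv (deriv ρ) t₀ := by
    intro t ht
    have h1 := congrArg Prod.snd (hgraph t ht f₀ hf₀)
    rw [(hcoef t ht x₀ hx₀ u₀ hu₀ a₀ ha₀ b₀ hb₀ f₀ hf₀ g₀ hg₀).2,
      (hcoef t₀ ht₀ x₀ hx₀ u₀ hu₀ a₀ ha₀ b₀ hb₀ f₀ hf₀ g₀ hg₀).2, hτ'' t ht, hτ'' t₀ ht₀,
      hτ' t ht, sub_left_inj, div_left_inj' (pow_ne_zero 2 (hne t₀ ht₀ x₀ hx₀).1)] at h1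
    linarith
  obtain ⟨c₀, hc₀⟩ : ∃ c₀, ∀ t ∈ Metric.ball t₀ ε, τ t = deriv τ t₀ * t + c₀ := by
    refine ⟨τ t₀ - deriv τ t₀ * t₀, fun t ht => ?_⟩
    have := eq_of_hasDerivAt_zero_on_ball (f := fun t => τ t - deriv τ t₀ * t) (fun s hs => by
      have := (dτ s hs).hasDerivAt.fun_sub ((hasDerivAt_id s).const_mul (deriv τ t₀))
      rwa [hτ' s hs, mul_one, sub_self] at this) ht ht₀
    linear_combination this
  obtain ⟨c₃, hc₃⟩ : ∃ c₃, ∀ t ∈ Metric.ball t₀ ε,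
      deriv ρ t = deriv (deriv ρ) t₀ * t + c₃ := by
    refine ⟨deriv ρ t₀ - deriv (deriv ρ) t₀ * t₀, fun t ht => ?_⟩
    have := eq_of_hasDerivAt_zero_on_ball (f := fun t => deriv ρ t - deriv (deriv ρ) t₀ * t)
      (fun s hs => by
        have := (dρ' s hs).hasDerivAt.fun_sub ((hasDerivAt_id s).const_mul (deriv (deriv ρ) t₀))
        rwa [hρ'' s hs, mul_one, sub_self] at this) ht ht₀
    linear_combination this
  obtain ⟨k, hk⟩ : ∃ k, ∀ t ∈ Metric.ball t₀ ε,
      ρ t = deriv (deriv ρ) t₀ / 2 * t ^ 2 + c₃ * t + k := by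
    refine ⟨ρ t₀ - (deriv (deriv ρ) t₀ / 2 * t₀ ^ 2 + c₃ * t₀), fun t ht => ?_⟩
    have := eq_of_hasDerivAt_zero_on_ball
      (f := fun t => ρ t - (deriv (deriv ρ) t₀ / 2 * t ^ 2 + c₃ * t)) (fun s hs => by
        have := (dρ s hs).hasDerivAt.fun_sub
          ((((hasDerivAt_id s).fun_pow 2).const_mul (deriv (deriv ρ) t₀ / 2)).fun_add
            ((hasDerivAt_id s).const_mul c₃))
        refine this.congr_deriv ?_
        rw [hc₃ s hs]
        simp
        ring) ht ht₀
    linear_combination this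
  have hx : xDomain (Metric.ball ((((t₀, x₀, u₀), (a₀, b₀)), (f₀, g₀)) : Ext) ε) ⊆
      Metric.ball x₀ ε := by
    rintro _ ⟨_, ⟨_, ⟨⟨⟨⟨t, x, u⟩, a, b⟩, f, g⟩, hm, rfl⟩, rfl⟩, rfl⟩
    exact (mem_ball_ext.1 hm).1.1.2.1
  have hψk : deriv (fun x => ψ x + k) = deriv ψ := by
    funext x
    exact deriv_add_const k
  refine ⟨c₀, deriv τ t₀, c, c₃, deriv (deriv ρ) t₀ / 2, ξ, fun x => ψ x + k,
    mul_ne_zero (hne t₀ ht₀ x₀ hx₀).1 hc, hξ.mono hx, (hψ.mono hx).add contDiffOn_const,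
    fun x hx' => (hne t₀ ht₀ x (hx hx')).2, ?_⟩
  intro t x u a b f g hmem
  obtain ⟨⟨⟨ht, hx, hu⟩, ha, hb⟩, hf, hg⟩ := mem_ball_ext.1 hmem
  rw [hψk]
  have n1 := (hne t₀ ht₀ x₀ hx₀).1
  have n2 := (hne t ht x hx).2
  obtain ⟨e1, e2⟩ := hcoef t ht x hx u hu a ha b hb f hf g hg
  refine Prod.ext ?_ (Prod.ext ?_ ?_)
  · rw [h.fst_eq _ (hball hmem), hjet t ht x hx u hu a ha b hb]
    simp only [sepJet, sepMap]
    rw [hc₀ t ht, hk t ht, hτ' t ht, hc₃ t ht]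
    refine Prod.ext (Prod.ext rfl (Prod.ext rfl ?_)) (Prod.ext ?_ rfl)
    · simp only
      ring
    · simp only
      ring
  · rw [e1, hτ' t ht]
  · rw [e2, hτ' t ht, hτ'' t ht, hρ'' t ht]
    simp only
    field_simp
    ring

/-! ### Gluing explicit forms -/

/-- The parameters of the explicit form are determined by the transformation of `(t, x, u)` near a
point. -/
theorem parameters_unique {c₀ c₁ c₂ c₃ c₄ d₀ d₁ d₂ d₃ d₄ : ℝ} {α β α' β' : ℝ → ℝ} {z : Base}
    (h : ∀ᶠ y in 𝓝 z,
      sepMap c₂ (fun t => c₁ * t + c₀) α (fun t => c₄ * t ^ 2 + c₃ * t) β y =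
      sepMap d₂ (fun t => d₁ * t + d₀) α' (fun t => d₄ * t ^ 2 + d₃ * t) β' y) :
    (c₀ = d₀ ∧ c₁ = d₁ ∧ c₂ = d₂ ∧ c₃ = d₃ ∧ c₄ = d₄) ∧ α z.2.1 = α' z.2.1 ∧
      β z.2.1 = β' z.2.1 := by
  obtain ⟨t, x, u⟩ := z
  obtain ⟨ε, hε, hb⟩ := Metric.eventually_nhds_iff_ball.1 h
  have hs : ∀ r s : ℝ, |r| < ε → |s| < ε → ((t + r, x, u + s) : Base) ∈ Metric.ball (t, x, u) ε := by
    intro r s hr hs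
    simp only [← ball_prod_same, mem_prod, Metric.mem_ball, Real.dist_eq, add_sub_cancel_left,
      sub_self, abs_zero]
    exact ⟨hr, hε, hs⟩
  set δ := ε / 2 with hδ
  have hδ0 : δ ≠ 0 := by positivity
  have h0 : |(0 : ℝ)| < ε := by simpa using hε
  have h1 : |δ| < ε := by rw [abs_of_pos (by positivity)]; linarith
  have h2 : |-δ| < ε := by rwa [abs_neg]
  have e0 := hb _ (hs 0 0 h0 h0)
  have e1 := hb _ (hs δ 0 h1 h0)
  have e2 := hb _ (hs (-δ) 0 h2 h0)
  have e3 := hb _ (hs 0 δ h0 h1)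
  simp only [sepMap, Prod.mk.injEq] at e0 e1 e2 e3
  have hc₁ : c₁ = d₁ := mul_right_cancel₀ hδ0 (by linear_combination e1.1 - e0.1)
  have hc₀ : c₀ = d₀ := by
    have := e0.1
    rw [hc₁] at this
    linarith
  have hc₂ : c₂ = d₂ := mul_right_cancel₀ hδ0 (by linear_combination e3.2.2 - e0.2.2)
  -- second differences in `t`
  have hc₄ : c₄ = d₄ := mul_right_cancel₀ (pow_ne_zero 2 hδ0)
    (by linear_combination (e1.2.2 + e2.2.2) / 2 - e0.2.2)
  have hc₃ : c₃ = d₃ := mul_right_cancel₀ hδ0 (by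
    rw [hc₄] at e0 e1
    linear_combination e1.2.2 - e0.2.2)
  refine ⟨⟨hc₀, hc₁, hc₂, hc₃, hc₄⟩, e0.2.1, ?_⟩
  have := e0.2.2
  rw [hc₂, hc₃, hc₄] at this
  linarith

/-- An equivalence transformation has one explicit form on all of its domain if the domain has a
connected projection to the space of `(t, x, u)`, with preconnected slices `x = const`: the
constants in the local explicit forms are locally constant on the projection, and the values at `x`
of the two functions are locally constant on the slice over `x`. -/
theorem IsEquivalenceTransformation.hasExplicitForm {Φ : Ext → Ext} {M : Set Ext}
    (h : IsEquivalenceTransformation Φ M) (hD : IsConnected (baseDomain M))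
    (hslice : ∀ x : ℝ, IsPreconnected {z | z ∈ baseDomain M ∧ z.2.1 = x}) :
    HasExplicitForm Φ M := by
  obtain ⟨φ, hφ⟩ : ∃ φ : Base → Base, ∀ m ∈ M, (Φ m).1.1 = φ m.1.1 := by
    obtain ⟨-, φ, -, -, -, hφ, -⟩ := h
    exact ⟨φ, hφ⟩
  obtain ⟨_, _, hpt⟩ := h.exists_pointwise
  have key : ∀ m ∈ M, ∃ N ⊆ M, IsOpen N ∧ m ∈ N ∧ HasExplicitForm Φ N :=
    fun m hm => hpt.exists_explicitForm hm
  choose! N hNM hNo hmN c₀ c₁ c₂ c₃ c₄ α β hc hα hβ hα0 hform using key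
  have hbase : ∀ m ∈ M, ∀ y ∈ baseDomain (N m), φ y =
      sepMap (c₂ m) (fun t => c₁ m * t + c₀ m) (α m) (fun t => c₄ m * t ^ 2 + c₃ m * t) (β m) y := by
    rintro m hm _ ⟨_, ⟨⟨⟨⟨t, x, u⟩, a, b⟩, f, g⟩, hk, rfl⟩, rfl⟩
    have h1 := hφ _ (hNM m hm hk)
    rw [hform m hm t x u a b f g hk] at h1
    rw [← h1]
    simp only [sepMap, Prod.mk.injEq, true_and]
    ring
  have hVo : ∀ m ∈ M, IsOpen (baseDomain (N m)) := fun m hm => isOpen_baseDomain (hNo m hm)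
  have hagree : ∀ m ∈ M, ∀ m' ∈ M, ∀ y ∈ baseDomain (N m), y ∈ baseDomain (N m') →
      (c₀ m = c₀ m' ∧ c₁ m = c₁ m' ∧ c₂ m = c₂ m' ∧ c₃ m = c₃ m' ∧ c₄ m = c₄ m') ∧
        α m y.2.1 = α m' y.2.1 ∧ β m y.2.1 = β m' y.2.1 := by
    intro m hm m' hm' y hy hy'
    apply parameters_unique
    filter_upwards [(hVo m hm).mem_nhds hy, (hVo m' hm').mem_nhds hy'] with w hw hw'
    rw [← hbase m hm w hw, hbase m' hm' w hw']
  have hlift : ∀ z ∈ baseDomain M, ∃ m ∈ M, m.1.1 = z := by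
    rintro _ ⟨_, ⟨m, hm, rfl⟩, rfl⟩
    exact ⟨m, hm, rfl⟩
  choose! p hpM hpz using hlift
  have hself : ∀ m ∈ M, m.1.1 ∈ baseDomain (N m) := fun m hm => ⟨m.1, ⟨m, hmN m hm, rfl⟩, rfl⟩
  have hpself : ∀ z ∈ baseDomain M, z ∈ baseDomain (N (p z)) := by
    intro z hz
    have := hself _ (hpM z hz)
    rwa [hpz z hz] at this
  obtain ⟨z₀, hz₀⟩ := hD.nonempty
  have hconst : ∀ m ∈ M, c₀ m = c₀ (p z₀) ∧ c₁ m = c₁ (p z₀) ∧ c₂ m = c₂ (p z₀) ∧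
      c₃ m = c₃ (p z₀) ∧ c₄ m = c₄ (p z₀) := by
    intro m hm
    have hz : m.1.1 ∈ baseDomain M := ⟨m.1, ⟨m, hm, rfl⟩, rfl⟩
    have h1 := (hagree m hm _ (hpM _ hz) _ (hself m hm) (hpself _ hz)).1
    have h2 := hD.isPreconnected.induction₂ (fun y z => c₀ (p y) = c₀ (p z) ∧
      c₁ (p y) = c₁ (p z) ∧ c₂ (p y) = c₂ (p z) ∧ c₃ (p y) = c₃ (p z) ∧ c₄ (p y) = c₄ (p z))
      (fun y hy => by
        filter_upwards [self_mem_nhdsWithin, mem_nhdsWithin_of_mem_nhds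
          ((hVo _ (hpM y hy)).mem_nhds (hpself y hy))] with w hw hwy
        exact (hagree _ (hpM y hy) _ (hpM w hw) w hwy (hpself w hw)).1)
      (by
        rintro x y z - - - ⟨a0, a1, a2, a3, a4⟩ ⟨b0, b1, b2, b3, b4⟩
        exact ⟨a0.trans b0, a1.trans b1, a2.trans b2, a3.trans b3, a4.trans b4⟩)
      (by
        rintro x y - - ⟨a0, a1, a2, a3, a4⟩
        exact ⟨a0.symm, a1.symm, a2.symm, a3.symm, a4.symm⟩) hz hz₀
    obtain ⟨a0, a1, a2, a3, a4⟩ := h1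
    obtain ⟨b0, b1, b2, b3, b4⟩ := h2
    exact ⟨a0.trans b0, a1.trans b1, a2.trans b2, a3.trans b3, a4.trans b4⟩
  have hfun : ∀ y ∈ baseDomain M, ∀ z ∈ baseDomain M, y.2.1 = z.2.1 →
      α (p y) y.2.1 = α (p z) z.2.1 ∧ β (p y) y.2.1 = β (p z) z.2.1 := by
    intro y hy z hz hyz
    refine (hslice z.2.1).induction₂ (fun y z => α (p y) y.2.1 = α (p z) z.2.1 ∧
      β (p y) y.2.1 = β (p z) z.2.1) (fun y hy => ?_) ?_ ?_ ⟨hy, hyz⟩ ⟨hz, rfl⟩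
    · filter_upwards [self_mem_nhdsWithin, mem_nhdsWithin_of_mem_nhds
        ((hVo _ (hpM y hy.1)).mem_nhds (hpself y hy.1))] with w hw hwy
      have := (hagree _ (hpM y hy.1) _ (hpM w hw.1) w hwy (hpself w hw.1)).2
      rwa [show y.2.1 = w.2.1 from hy.2.trans hw.2.symm]
    · rintro x y z - - - ⟨a0, a1⟩ ⟨b0, b1⟩
      exact ⟨a0.trans b0, a1.trans b1⟩
    · rintro x y - - ⟨a0, a1⟩
      exact ⟨a0.symm, a1.symm⟩
  have hx : ∀ x ∈ xDomain M, ∃ z ∈ baseDomain M, z.2.1 = x := fun x hx => hx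
  choose! σ hσD hσx using hx
  -- near `x`, the glued functions agree with those of any local form at a point over `x`
  have hnear : ∀ m ∈ M, ((fun x => α (p (σ x)) x) =ᶠ[𝓝 m.1.1.2.1] α m) ∧
      ((fun x => β (p (σ x)) x) =ᶠ[𝓝 m.1.1.2.1] β m) := by
    intro m hm
    have h1 : ∀ x ∈ xDomain (N m), α (p (σ x)) x = α m x ∧ β (p (σ x)) x = β m x := by
      rintro _ ⟨y, hy, rfl⟩
      have hyD : y ∈ baseDomain M := image_mono (image_mono (hNM m hm)) hy
      have hyx : y.2.1 ∈ xDomain M := ⟨y, hyD, rfl⟩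
      have h2 := hfun _ (hσD _ hyx) y hyD (hσx _ hyx)
      have h3 := (hagree _ (hpM y hyD) m hm y (hpself y hyD) hy).2
      rw [hσx _ hyx] at h2
      exact ⟨h2.1.trans h3.1, h2.2.trans h3.2⟩
    have h2 := (isOpen_xDomain (hNo m hm)).mem_nhds ⟨m.1.1, hself m hm, rfl⟩
    exact ⟨by filter_upwards [h2] with x hx using (h1 x hx).1,
      by filter_upwards [h2] with x hx using (h1 x hx).2⟩
  have hxM : ∀ x ∈ xDomain M, ∃ m ∈ M, m.1.1.2.1 = x := by
    rintro _ ⟨z, hz, rfl⟩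
    exact ⟨p z, hpM z hz, by rw [hpz z hz]⟩
  have hxN : ∀ m ∈ M, m.1.1.2.1 ∈ xDomain (N m) := fun m hm => ⟨_, hself m hm, rfl⟩
  refine ⟨c₀ (p z₀), c₁ (p z₀), c₂ (p z₀), c₃ (p z₀), c₄ (p z₀), fun x => α (p (σ x)) x,
    fun x => β (p (σ x)) x, hc _ (hpM _ hz₀), ?_, ?_, ?_, ?_⟩
  · intro x hx
    obtain ⟨m, hm, rfl⟩ := hxM x hx
    exact (((hα m hm).contDiffAt ((isOpen_xDomain (hNo m hm)).mem_nhds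
      (hxN m hm))).congr_of_eventuallyEq (hnear m hm).1).contDiffWithinAt
  · intro x hx
    obtain ⟨m, hm, rfl⟩ := hxM x hx
    exact (((hβ m hm).contDiffAt ((isOpen_xDomain (hNo m hm)).mem_nhds
      (hxN m hm))).congr_of_eventuallyEq (hnear m hm).2).contDiffWithinAt
  · intro x hx
    obtain ⟨m, hm, rfl⟩ := hxM x hx
    rw [(hnear m hm).1.deriv_eq]
    exact hα0 m hm _ (hxN m hm)
  · intro t x u a b f g hm
    obtain ⟨e0, e1, e2, e3, e4⟩ := hconst _ hm
    have hn := hnear _ hm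
    rw [hform _ hm t x u a b f g (hmN _ hm), hn.1.deriv_eq, hn.2.deriv_eq,
      hn.1.deriv.deriv_eq, hn.2.deriv.deriv_eq, ← hn.1.eq_of_nhds, ← hn.2.eq_of_nhds, e0, e1, e2,
      e3, e4]

/-! ### Maps of the explicit form -/

/-- The transformation of the arguments `(x, u_x)`. -/
noncomputable def argMap (c₂ : ℝ) (ξ ψ : ℝ → ℝ) (w : ℝ × ℝ) : ℝ × ℝ :=
  (ξ w.1, (c₂ * w.2 + deriv ψ w.1) / deriv ξ w.1)

/-- The transformation of the values `v = (f, g)` over the arguments `w = (x, u_x)`. -/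
noncomputable def coefMap (c₁ c₂ c₄ : ℝ) (ξ ψ : ℝ → ℝ) (w v : ℝ × ℝ) : ℝ × ℝ :=
  (deriv ξ w.1 ^ 2 / c₁ ^ 2 * v.1,
    1 / c₁ ^ 2 * (c₂ * v.2 + (c₂ * w.2 + deriv ψ w.1) / deriv ξ w.1 * deriv (deriv ξ) w.1 * v.1
      - deriv (deriv ψ) w.1 * v.1 + 2 * c₄))

/-- The standing assumptions on the parameters `c₁`, `c₂`, `φ = ξ`, `ψ` of the explicit form, with
`ξ` moreover injective on the set `I` of values of `x`. -/
structure IsExplicitData (c₁ c₂ : ℝ) (ξ ψ : ℝ → ℝ) (I : Set ℝ) : Prop where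
  c₁_ne : c₁ ≠ 0
  c₂_ne : c₂ ≠ 0
  isOpen : IsOpen I
  ξ_smooth : ContDiffOn ℝ ∞ ξ I
  ψ_smooth : ContDiffOn ℝ ∞ ψ I
  ξ_ne : ∀ x ∈ I, deriv ξ x ≠ 0
  ξ_injOn : InjOn ξ I

theorem injOn_of_deriv_ne_zero {ξ : ℝ → ℝ} {I : Set ℝ} (hI : IsPreconnected I)
    (hξ : ContDiffOn ℝ ∞ ξ I) (h0 : ∀ x ∈ I, deriv ξ x ≠ 0) : InjOn ξ I := by
  have hlt : ∀ x ∈ I, ∀ y ∈ I, x < y → ξ x ≠ ξ y := by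
    intro x hx y hy hxy heq
    have hsub : Icc x y ⊆ I := hI.ordConnected.out hx hy
    obtain ⟨z, hz, hz0⟩ := exists_deriv_eq_zero hxy (hξ.continuousOn.mono hsub) heq
    exact h0 z (hsub (Ioo_subset_Icc_self hz)) hz0
  intro x hx y hy heq
  rcases lt_trichotomy x y with h | h | h
  · exact absurd heq (hlt x hx y hy h)
  · exact h
  · exact absurd heq.symm (hlt y hy x hx h)

namespace IsExplicitData

variable {c₀ c₁ c₂ c₃ c₄ : ℝ} {ξ ψ : ℝ → ℝ} {I : Set ℝ} {M : Set Ext}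

theorem contDiffOn_comp {E : Type*} [NormedAddCommGroup E] [NormedSpace ℝ E] {π : E → ℝ} {s : Set E}
    (h : IsExplicitData c₁ c₂ ξ ψ I) (hπ : ContDiff ℝ ∞ π) (hs : MapsTo π s I) :
    (ContDiffOn ℝ ∞ (fun z => ξ (π z)) s ∧ ContDiffOn ℝ ∞ (fun z => deriv ξ (π z)) s ∧
      ContDiffOn ℝ ∞ (fun z => deriv (deriv ξ) (π z)) s) ∧
    ContDiffOn ℝ ∞ (fun z => ψ (π z)) s ∧ ContDiffOn ℝ ∞ (fun z => deriv ψ (π z)) s ∧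
      ContDiffOn ℝ ∞ (fun z => deriv (deriv ψ) (π z)) s :=
  have h1 := h.ξ_smooth.deriv_infty h.isOpen
  have h2 := h.ψ_smooth.deriv_infty h.isOpen
  ⟨⟨h.ξ_smooth.comp hπ.contDiffOn hs, h1.comp hπ.contDiffOn hs,
    (h1.deriv_infty h.isOpen).comp hπ.contDiffOn hs⟩,
    h.ψ_smooth.comp hπ.contDiffOn hs, h2.comp hπ.contDiffOn hs,
    (h2.deriv_infty h.isOpen).comp hπ.contDiffOn hs⟩

theorem contDiffOn_argMap {E : Type*} [NormedAddCommGroup E] [NormedSpace ℝ E] {π : E → ℝ × ℝ}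
    {s : Set E} (h : IsExplicitData c₁ c₂ ξ ψ I) (hπ : ContDiff ℝ ∞ π)
    (hs : MapsTo (fun z => (π z).1) s I) :
    ContDiffOn ℝ ∞ (fun z => argMap c₂ ξ ψ (π z)) s := by
  obtain ⟨⟨h1, h2, -⟩, -, h4, -⟩ := h.contDiffOn_comp hπ.fst hs
  exact h1.prodMk (((contDiffOn_const.mul hπ.snd.contDiffOn).add h4).div h2
    fun z hz => h.ξ_ne _ (hs hz))

theorem contDiffOn_coefMap {E : Type*} [NormedAddCommGroup E] [NormedSpace ℝ E] {π v : E → ℝ × ℝ}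
    {s : Set E} (h : IsExplicitData c₁ c₂ ξ ψ I) (hπ : ContDiffOn ℝ ∞ π s)
    (hv : ContDiffOn ℝ ∞ v s) (hs : MapsTo (fun z => (π z).1) s I) :
    ContDiffOn ℝ ∞ (fun z => coefMap c₁ c₂ c₄ ξ ψ (π z) (v z)) s := by
  have d1 := h.ξ_smooth.deriv_infty h.isOpen
  have d2 := h.ψ_smooth.deriv_infty h.isOpen
  have h1 := d1.comp hπ.fst hs
  have h2 := (d1.deriv_infty h.isOpen).comp hπ.fst hs
  have h3 := d2.comp hπ.fst hs
  have h4 := (d2.deriv_infty h.isOpen).comp hπ.fst hs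
  have h5 := ((contDiffOn_const (c := c₂)).mul hπ.snd).add h3 |>.div h1
    fun z hz => h.ξ_ne _ (hs hz)
  exact (((h1.pow 2).div_const _).mul hv.fst).prodMk (contDiffOn_const.mul
    ((((contDiffOn_const.mul hv.snd).add ((h5.mul h2).mul hv.fst)).sub (h4.mul hv.fst)).add
      contDiffOn_const))

theorem argMap_isPointTransformation (h : IsExplicitData c₁ c₂ ξ ψ I) :
    IsPointTransformation (argMap c₂ ξ ψ) {w | w.1 ∈ I} := by
  have hopen : IsOpen {w : ℝ × ℝ | w.1 ∈ I} := h.isOpen.preimage continuous_fst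
  have hsm : ContDiffOn ℝ ∞ (argMap c₂ ξ ψ) {w | w.1 ∈ I} :=
    h.contDiffOn_argMap contDiff_id fun w hw => hw
  refine ⟨hopen, hsm, ?_, ?_⟩
  · rintro ⟨x, p⟩ hx ⟨y, q⟩ hy heq
    simp only [argMap, Prod.mk.injEq] at heq
    obtain rfl := h.ξ_injOn hx hy heq.1
    have h1 := heq.2
    rw [div_left_inj' (h.ξ_ne x hx), add_left_inj] at h1
    rw [mul_left_cancel₀ h.c₂_ne h1]
  · intro w hw
    apply bijective_of_ker_eq_zero
    intro v hv
    have hd := (hsm.contDiffAt (hopen.mem_nhds hw)).differentiableAt (by simp)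
    have hline := hd.hasFDerivAt.hasLineDerivAt v
    rw [hv] at hline
    have h1 := (h.ξ_smooth.differentiableAt_of_isOpen h.isOpen hw).hasDerivAt_add_smul v.1
    have hv1 : v.1 = 0 := by
      have := h1.unique (HasDerivAt.prod_fst hline)
      exact (mul_eq_zero.1 this).resolve_left (h.ξ_ne _ hw)
    have h2 : HasDerivAt (fun s : ℝ => (c₂ * (w.2 + s * v.2) + deriv ψ w.1) / deriv ξ w.1)
        (c₂ * v.2 / deriv ξ w.1) 0 := by
      simpa using (((((hasDerivAt_id (0 : ℝ)).mul_const v.2).const_add w.2).const_mul c₂).add_const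
        (deriv ψ w.1)).div_const (deriv ξ w.1)
    have h3 : HasDerivAt (fun s : ℝ => (c₂ * (w.2 + s * v.2) + deriv ψ w.1) / deriv ξ w.1) 0 0 := by
      have := HasDerivAt.prod_snd hline
      simpa [argMap, hv1] using this
    have hv2 : v.2 = 0 := by
      have := h2.unique h3
      rw [div_eq_zero_iff, mul_eq_zero] at this
      exact (this.resolve_right (h.ξ_ne _ hw)).resolve_left h.c₂_ne
    exact Prod.ext hv1 hv2

theorem coefMap_injective (h : IsExplicitData c₁ c₂ ξ ψ I) {w : ℝ × ℝ} (hw : w.1 ∈ I) :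
    Function.Injective (coefMap c₁ c₂ c₄ ξ ψ w) := by
  rintro ⟨f, g⟩ ⟨f', g'⟩ heq
  have h1 := h.c₁_ne
  have h2 := h.ξ_ne _ hw
  simp only [coefMap, Prod.mk.injEq] at heq
  obtain ⟨e1, e2⟩ := heq
  have hf : f = f' := mul_left_cancel₀ (div_ne_zero (pow_ne_zero 2 h2) (pow_ne_zero 2 h1)) e1
  subst hf
  have e3 := mul_left_cancel₀ (one_div_ne_zero (pow_ne_zero 2 h1)) e2
  have e4 : c₂ * g = c₂ * g' := by linarith
  rw [mul_left_cancel₀ h.c₂_ne e4]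

end IsExplicitData

theorem hasDerivAt_affine (a b x : ℝ) : HasDerivAt (fun t : ℝ => a * t + b) a x := by
  simpa using ((hasDerivAt_id x).const_mul a).add_const b

theorem hasDerivAt_quadratic (a b x : ℝ) :
    HasDerivAt (fun t : ℝ => a * t ^ 2 + b * t) (2 * a * x + b) x := by
  have := (((hasDerivAt_id x).fun_pow 2).const_mul a).fun_add ((hasDerivAt_id x).const_mul b)
  refine this.congr_deriv ?_
  simp
  ring

theorem deriv_affine (a b : ℝ) : deriv (fun t : ℝ => a * t + b) = fun _ => a :=
  funext fun x => (hasDerivAt_affine a b x).deriv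

theorem deriv_quadratic (a b : ℝ) :
    deriv (fun t : ℝ => a * t ^ 2 + b * t) = fun t => 2 * a * t + b :=
  funext fun x => (hasDerivAt_quadratic a b x).deriv

namespace IsExplicitData

variable {c₀ c₁ c₂ c₃ c₄ : ℝ} {ξ ψ : ℝ → ℝ} {I : Set ℝ} {M : Set Ext}

theorem sepRegular (h : IsExplicitData c₁ c₂ ξ ψ I) {j : Jet} (hj : j.1.2.1 ∈ I) :
    SepRegular (fun t => c₁ * t + c₀) ξ (fun t => c₄ * t ^ 2 + c₃ * t) ψ j :=
  .of_contDiffOn h.isOpen isOpen_univ (by fun_prop) h.ξ_smooth (by fun_prop) h.ψ_smooth trivial hj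
    (by rw [deriv_affine]; exact h.c₁_ne) (h.ξ_ne _ hj)

theorem contDiffOn_sepMap {E : Type*} [NormedAddCommGroup E] [NormedSpace ℝ E] {π : E → Base}
    {s : Set E} (h : IsExplicitData c₁ c₂ ξ ψ I) (hπ : ContDiff ℝ ∞ π)
    (hs : MapsTo (fun z => (π z).2.1) s I) : ContDiffOn ℝ ∞ (fun z =>
      sepMap c₂ (fun t => c₁ * t + c₀) ξ (fun t => c₄ * t ^ 2 + c₃ * t) ψ (π z)) s := by
  obtain ⟨⟨h1, -⟩, h2, -⟩ := h.contDiffOn_comp hπ.snd.fst hs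
  have ht : ContDiffOn ℝ ∞ (fun z => (π z).1) s := hπ.fst.contDiffOn
  have hu : ContDiffOn ℝ ∞ (fun z => (π z).2.2) s := hπ.snd.snd.contDiffOn
  exact ((contDiffOn_const.mul ht).add contDiffOn_const).prodMk
    (h1.prodMk (((contDiffOn_const.mul hu).add
      ((contDiffOn_const.mul (ht.pow 2)).add (contDiffOn_const.mul ht))).add h2))

theorem contDiffOn_sepJet {E : Type*} [NormedAddCommGroup E] [NormedSpace ℝ E] {π : E → Jet}
    {s : Set E} (h : IsExplicitData c₁ c₂ ξ ψ I) (hπ : ContDiff ℝ ∞ π)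
    (hs : MapsTo (fun z => (π z).1.2.1) s I) : ContDiffOn ℝ ∞ (fun z =>
      sepJet c₂ (fun t => c₁ * t + c₀) ξ (fun t => c₄ * t ^ 2 + c₃ * t) ψ (π z)) s := by
  have h1 := h.contDiffOn_sepMap (c₀ := c₀) (c₃ := c₃) (c₄ := c₄) hπ.fst hs
  have harg : ContDiff ℝ ∞ fun z => arg (π z) := hπ.fst.snd.fst.prodMk hπ.snd.snd
  have h2 := (h.contDiffOn_argMap harg hs).snd
  have ht : ContDiffOn ℝ ∞ (fun z => (π z).1.1) s := hπ.fst.fst.contDiffOn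
  have ha : ContDiffOn ℝ ∞ (fun z => (π z).2.1) s := hπ.snd.fst.contDiffOn
  have h3 : ContDiffOn ℝ ∞ (fun z => (c₂ * (π z).2.1 + (2 * c₄ * (π z).1.1 + c₃)) / c₁) s :=
    ((contDiffOn_const.mul ha).add ((contDiffOn_const.mul ht).add contDiffOn_const)).div_const _
  have e : (fun z => sepJet c₂ (fun t => c₁ * t + c₀) ξ (fun t => c₄ * t ^ 2 + c₃ * t) ψ (π z)) =
      fun z => (sepMap c₂ (fun t => c₁ * t + c₀) ξ (fun t => c₄ * t ^ 2 + c₃ * t) ψ (π z).1,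
        ((c₂ * (π z).2.1 + (2 * c₄ * (π z).1.1 + c₃)) / c₁, (argMap c₂ ξ ψ (arg (π z))).2)) := by
    funext z
    rw [sepJet, deriv_affine, deriv_quadratic]
    rfl
  rw [e]
  exact h1.prodMk (h3.prodMk h2)

theorem sepMap_isPointTransformation (h : IsExplicitData c₁ c₂ ξ ψ I) {D : Set Base}
    (hD : IsOpen D) (hDI : MapsTo (fun z : Base => z.2.1) D I) : IsPointTransformation
      (sepMap c₂ (fun t => c₁ * t + c₀) ξ (fun t => c₄ * t ^ 2 + c₃ * t) ψ) D := by
  refine ⟨hD, h.contDiffOn_sepMap contDiff_id hDI, ?_, ?_⟩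
  · rintro ⟨t, x, u⟩ hz ⟨t', x', u'⟩ hz' heq
    simp only [sepMap, Prod.mk.injEq] at heq
    obtain ⟨e1, e2, e3⟩ := heq
    obtain rfl := h.ξ_injOn (hDI hz) (hDI hz') e2
    obtain rfl := mul_left_cancel₀ h.c₁_ne (add_right_cancel e1)
    obtain rfl := mul_left_cancel₀ h.c₂_ne (add_right_cancel (add_right_cancel e3))
    rfl
  · intro z hz
    apply bijective_of_ker_eq_zero
    intro v hv
    have hr := h.sepRegular (c₀ := c₀) (c₃ := c₃) (c₄ := c₄) (j := (z, (0, 0))) (hDI hz)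
    rw [fderiv_sepMap hr.τ₁ hr.ξ₁ hr.ρ₁ hr.ψ₁] at hv
    simp only [Prod.mk_eq_zero] at hv
    obtain ⟨e1, e2, e3⟩ := hv
    have hv1 : v.1 = 0 := (mul_eq_zero.1 e1).resolve_left hr.τ_ne
    have hv2 : v.2.1 = 0 := (mul_eq_zero.1 e2).resolve_left hr.ξ_ne
    rw [hv1, hv2, mul_zero, mul_zero, add_zero, add_zero] at e3
    exact Prod.ext hv1 (Prod.ext hv2 ((mul_eq_zero.1 e3).resolve_left h.c₂_ne))

theorem sepJet_isPointTransformation (h : IsExplicitData c₁ c₂ ξ ψ I) {J : Set Jet}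
    (hJ : IsOpen J) (hJI : MapsTo (fun j : Jet => j.1.2.1) J I) : IsPointTransformation
      (sepJet c₂ (fun t => c₁ * t + c₀) ξ (fun t => c₄ * t ^ 2 + c₃ * t) ψ) J := by
  have hbase := h.sepMap_isPointTransformation (c₀ := c₀) (c₃ := c₃) (c₄ := c₄)
    (isOpenMap_fst (X := Base) (Y := ℝ × ℝ) _ hJ) (by rintro _ ⟨j, hj, rfl⟩; exact hJI hj)
  refine ⟨hJ, h.contDiffOn_sepJet contDiff_id hJI, ?_, ?_⟩
  · rintro ⟨z, a, b⟩ hj ⟨z', a', b'⟩ hj' heq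
    simp only [sepJet, Prod.mk.injEq] at heq
    obtain ⟨e1, e2, e3⟩ := heq
    obtain rfl := hbase.injOn ⟨_, hj, rfl⟩ ⟨_, hj', rfl⟩ e1
    have hr := h.sepRegular (c₀ := c₀) (c₃ := c₃) (c₄ := c₄) (hJI hj)
    rw [div_left_inj' hr.τ_ne, add_left_inj] at e2
    rw [div_left_inj' hr.ξ_ne, add_left_inj] at e3
    rw [mul_left_cancel₀ h.c₂_ne e2, mul_left_cancel₀ h.c₂_ne e3]
  · intro j hj
    apply bijective_of_ker_eq_zero
    intro v hv
    have hr := h.sepRegular (c₀ := c₀) (c₃ := c₃) (c₄ := c₄) (hJI hj)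
    rw [fderiv_sepJet hr.τ₁ hr.ξ₁ hr.ρ₁ hr.ψ₁ hr.τ₂ hr.ξ₂ hr.ρ₂ hr.ψ₂ hr.τ_ne hr.ξ_ne] at hv
    simp only [Prod.mk_eq_zero] at hv
    obtain ⟨e1, e2, e3⟩ := hv
    have hv1 : v.1 = 0 := (hbase.nondegenerate j.1 ⟨j, hj, rfl⟩).1 (by rw [e1, map_zero])
    have h1 := hr.τ_ne
    have h2 := hr.ξ_ne
    have h3 := h.c₂_ne
    simp only [hv1, Prod.fst_zero, Prod.snd_zero, mul_zero, add_zero, sub_zero] at e2 e3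
    have hv2 : v.2.1 = 0 := by simpa [h.c₁_ne, h1, h3] using e2
    have hv3 : v.2.2 = 0 := by simpa [h2, h3] using e3
    exact Prod.ext hv1 (Prod.ext hv2 hv3)

theorem isPointTransformation (h : IsExplicitData c₁ c₂ ξ ψ I) (hM : IsOpen M)
    (hMI : MapsTo (fun m : Ext => m.1.1.2.1) M I) : IsPointTransformation
      (fun m : Ext => (sepJet c₂ (fun t => c₁ * t + c₀) ξ (fun t => c₄ * t ^ 2 + c₃ * t) ψ m.1,
        coefMap c₁ c₂ c₄ ξ ψ (arg m.1) m.2)) M := by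
  have hjet := h.sepJet_isPointTransformation (c₀ := c₀) (c₃ := c₃) (c₄ := c₄)
    (isOpen_jetDomain hM) (by rintro _ ⟨m, hm, rfl⟩; exact hMI hm)
  have hsm1 := h.contDiffOn_sepJet (c₀ := c₀) (c₃ := c₃) (c₄ := c₄)
    (contDiff_fst (𝕜 := ℝ) (E := Jet) (F := ℝ × ℝ)) hMI
  have harg : ContDiff ℝ ∞ fun m : Ext => arg m.1 :=
    contDiff_fst.fst.snd.fst.prodMk contDiff_fst.snd.snd
  have hsm2 := h.contDiffOn_coefMap (c₄ := c₄) harg.contDiffOn contDiffOn_snd hMI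
  refine ⟨hM, hsm1.prodMk hsm2, ?_, ?_⟩
  · rintro ⟨j, v⟩ hm ⟨j', v'⟩ hm' heq
    simp only [Prod.mk.injEq] at heq
    obtain rfl := hjet.injOn ⟨_, hm, rfl⟩ ⟨_, hm', rfl⟩ heq.1
    rw [h.coefMap_injective (w := arg j) (hMI hm) heq.2]
  · intro m hm
    apply bijective_of_ker_eq_zero
    intro v hv
    have hd1 := (hsm1.contDiffAt (hM.mem_nhds hm)).differentiableAt (by simp)
    have hd2 := (hsm2.contDiffAt (hM.mem_nhds hm)).differentiableAt (by simp)
    rw [hd1.fderiv_prodMk hd2] at hv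
    have e1 : fderiv ℝ (fun z : Ext => sepJet c₂ (fun t => c₁ * t + c₀) ξ
      (fun t => c₄ * t ^ 2 + c₃ * t) ψ z.1) m v = 0 := congrArg Prod.fst hv
    have e2 : fderiv ℝ (fun z : Ext => coefMap c₁ c₂ c₄ ξ ψ (arg z.1) z.2) m v = 0 :=
      congrArg Prod.snd hv
    have hj : m.1 ∈ jetDomain M := ⟨m, hm, rfl⟩
    have hdj := (hjet.smooth.contDiffAt (hjet.isOpen.mem_nhds hj)).differentiableAt (by simp)
    have hv1 : v.1 = 0 := by
      apply (hjet.nondegenerate _ hj).1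
      have := (hdj.hasFDerivAt.comp m hasFDerivAt_fst).unique hd1.hasFDerivAt
      rw [map_zero, ← e1, ← this]
      rfl
    have hline := hd2.hasFDerivAt.hasLineDerivAt v
    rw [e2] at hline
    -- along a line on which `(x, u_x)` is constant, `coefMap` is affine
    set k := (c₂ * (arg m.1).2 + deriv ψ (arg m.1).1) / deriv ξ (arg m.1).1 *
      deriv (deriv ξ) (arg m.1).1 with hk
    have hf : HasDerivAt (fun s : ℝ => deriv ξ (arg m.1).1 ^ 2 / c₁ ^ 2 * (m.2.1 + s * v.2.1)) 0 0 := by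
      have := HasDerivAt.prod_fst hline
      simpa [coefMap, hv1] using this
    have hg : HasDerivAt (fun s : ℝ => 1 / c₁ ^ 2 * (c₂ * (m.2.2 + s * v.2.2) +
        k * (m.2.1 + s * v.2.1) - deriv (deriv ψ) (arg m.1).1 * (m.2.1 + s * v.2.1) +
        2 * c₄)) 0 0 := by
      have := HasDerivAt.prod_snd hline
      simpa [coefMap, hv1] using this
    have hlin : ∀ a b : ℝ, HasDerivAt (fun s : ℝ => a + s * b) b 0 := fun a b => by
      simpa using ((hasDerivAt_id (0 : ℝ)).mul_const b).const_add a
    have hv2 : v.2.1 = 0 := by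
      have := ((hlin m.2.1 v.2.1).const_mul _).unique hf
      exact (mul_eq_zero.1 this).resolve_left
        (div_ne_zero (pow_ne_zero 2 (h.ξ_ne _ (hMI hm))) (pow_ne_zero 2 h.c₁_ne))
    have hv3 : v.2.2 = 0 := by
      have := (((((hlin m.2.2 v.2.2).const_mul c₂).fun_add ((hlin m.2.1 v.2.1).const_mul k)).fun_sub
        ((hlin m.2.1 v.2.1).const_mul (deriv (deriv ψ) (arg m.1).1))).add_const
          (2 * c₄)).const_mul (1 / c₁ ^ 2) |>.unique hg
      rw [hv2, mul_zero, mul_zero, add_zero, sub_zero] at this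
      exact (mul_eq_zero.1 ((mul_eq_zero.1 this).resolve_left
        (one_div_ne_zero (pow_ne_zero 2 h.c₁_ne)))).resolve_left h.c₂_ne
    exact Prod.ext hv1 (Prod.ext hv2 hv3)

end IsExplicitData

/-- The image of a tuple `θ` of arbitrary elements under a map of the explicit form, as a function of
the new arguments. It is meaningful on the image under `argMap` of the points with `x ∈ I`, where
`Function.invFunOn` is the inverse of `argMap`. -/
noncomputable def pushforward (c₁ c₂ c₄ : ℝ) (ξ ψ : ℝ → ℝ) (I : Set ℝ) (θ : ℝ × ℝ → ℝ × ℝ)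
    (w : ℝ × ℝ) : ℝ × ℝ :=
  coefMap c₁ c₂ c₄ ξ ψ (Function.invFunOn (argMap c₂ ξ ψ) {w | w.1 ∈ I} w)
    (θ (Function.invFunOn (argMap c₂ ξ ψ) {w | w.1 ∈ I} w))

namespace IsExplicitData

variable {c₀ c₁ c₂ c₃ c₄ : ℝ} {ξ ψ : ℝ → ℝ} {I : Set ℝ} {M : Set Ext}

/-- The inverse of `argMap` along a fibre `x = const`. -/
theorem invFunOn_argMap (h : IsExplicitData c₁ c₂ ξ ψ I) {x : ℝ} (hx : x ∈ I) (p : ℝ) :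
    Function.invFunOn (argMap c₂ ξ ψ) {w | w.1 ∈ I} (ξ x, p) =
      (x, deriv ξ x / c₂ * p + -(deriv ψ x / c₂)) := by
  have h1 : argMap c₂ ξ ψ (x, deriv ξ x / c₂ * p + -(deriv ψ x / c₂)) = (ξ x, p) := by
    have h2 := h.ξ_ne x hx
    have h3 := h.c₂_ne
    refine Prod.ext rfl ?_
    simp only [argMap]
    field_simp
    ring
  conv_lhs => rw [← h1]
  exact h.argMap_isPointTransformation.injOn.leftInvOn_invFunOn hx

theorem invFunOn_argMap_apply (h : IsExplicitData c₁ c₂ ξ ψ I) {w : ℝ × ℝ} (hw : w.1 ∈ I) :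
    Function.invFunOn (argMap c₂ ξ ψ) {w | w.1 ∈ I} (argMap c₂ ξ ψ w) = w :=
  h.argMap_isPointTransformation.injOn.leftInvOn_invFunOn hw

theorem pushforward_argMap (h : IsExplicitData c₁ c₂ ξ ψ I) (θ : ℝ × ℝ → ℝ × ℝ) {w : ℝ × ℝ}
    (hw : w.1 ∈ I) :
    pushforward c₁ c₂ c₄ ξ ψ I θ (argMap c₂ ξ ψ w) = coefMap c₁ c₂ c₄ ξ ψ w (θ w) := by
  rw [pushforward, h.invFunOn_argMap_apply hw]

/-- The condition `(f_{u_x}, g_{u_x u_x}) ≠ (0, 0)` is preserved: `f̃_{ũ_x̃}` is a nonzero multiple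
of `f_{u_x}`, and where `f_{u_x}` vanishes, `g̃_{ũ_x̃ ũ_x̃}` is a nonzero multiple of
`g_{u_x u_x}`. -/
theorem pushforward_nonlinear (h : IsExplicitData c₁ c₂ ξ ψ I) {θ : ℝ × ℝ → ℝ × ℝ}
    {W : Set (ℝ × ℝ)} (hθ : IsArbitraryElement θ W) (hWI : ∀ w ∈ W, w.1 ∈ I) :
    ∃ w ∈ argMap c₂ ξ ψ '' W,
      deriv (fun p => (pushforward c₁ c₂ c₄ ξ ψ I θ (w.1, p)).1) w.2 ≠ 0 ∨
      deriv (deriv (fun p => (pushforward c₁ c₂ c₄ ξ ψ I θ (w.1, p)).2)) w.2 ≠ 0 := by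
  have hc₁ := h.c₁_ne
  have hc₂ := h.c₂_ne
  have hdiff : ∀ w ∈ W, DifferentiableAt ℝ (fun p => θ (w.1, p)) w.2 := by
    intro w hw
    have h1 : DifferentiableAt ℝ θ (w.1, w.2) :=
      (hθ.smooth.contDiffAt (hθ.isOpen.mem_nhds hw)).differentiableAt (by simp)
    exact h1.comp w.2 ((differentiableAt_const w.1).prodMk differentiableAt_id)
  have hfst : ∀ x ∈ I, (fun p => (pushforward c₁ c₂ c₄ ξ ψ I θ (ξ x, p)).1) = fun p =>
      deriv ξ x ^ 2 / c₁ ^ 2 * (θ (x, deriv ξ x / c₂ * p + -(deriv ψ x / c₂))).1 := by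
    intro x hx
    funext p
    simp only [pushforward, h.invFunOn_argMap hx, coefMap]
  have hsnd : ∀ x ∈ I, (fun p => (pushforward c₁ c₂ c₄ ξ ψ I θ (ξ x, p)).2) = fun p =>
      1 / c₁ ^ 2 * (c₂ * (θ (x, deriv ξ x / c₂ * p + -(deriv ψ x / c₂))).2 +
        (p * deriv (deriv ξ) x - deriv (deriv ψ) x) *
          (θ (x, deriv ξ x / c₂ * p + -(deriv ψ x / c₂))).1 + 2 * c₄) := by
    intro x hx
    have hξ := h.ξ_ne x hx
    funext p
    simp only [pushforward, h.invFunOn_argMap hx, coefMap]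
    field_simp
    ring
  have hback : ∀ w ∈ W, deriv ξ w.1 / c₂ * (argMap c₂ ξ ψ w).2 + -(deriv ψ w.1 / c₂) = w.2 := by
    intro w hw
    have hξ := h.ξ_ne _ (hWI w hw)
    simp only [argMap]
    field_simp
    ring
  by_cases hf : ∃ w ∈ W, deriv (fun p => (θ (w.1, p)).1) w.2 ≠ 0
  · obtain ⟨w, hw, hfw⟩ := hf
    have hξ := h.ξ_ne _ (hWI w hw)
    refine ⟨_, ⟨w, hw, rfl⟩, Or.inl ?_⟩
    change deriv (fun p => (pushforward c₁ c₂ c₄ ξ ψ I θ (ξ w.1, p)).1) _ ≠ 0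
    rw [hfst _ (hWI w hw)]
    have h1 : HasDerivAt (fun p => (θ (w.1, p)).1) (deriv (fun p => (θ (w.1, p)).1) w.2)
        (deriv ξ w.1 / c₂ * (argMap c₂ ξ ψ w).2 + -(deriv ψ w.1 / c₂)) := by
      rw [hback w hw]
      exact (hdiff w hw).fst.hasDerivAt
    have h2 := (h1.comp (argMap c₂ ξ ψ w).2 (hasDerivAt_affine (deriv ξ w.1 / c₂)
      (-(deriv ψ w.1 / c₂)) (argMap c₂ ξ ψ w).2)).const_mul (deriv ξ w.1 ^ 2 / c₁ ^ 2)
    have h3 := h2.deriv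
    simp only [Function.comp_def] at h3
    rw [h3]
    positivity
  · push Not at hf
    obtain ⟨w, hw, hgw⟩ := hθ.nonlinear
    have hg : deriv (deriv (fun p => (θ (w.1, p)).2)) w.2 ≠ 0 :=
      hgw.resolve_left (not_not.2 (hf w hw))
    have hξ := h.ξ_ne _ (hWI w hw)
    have hx := hWI w hw
    refine ⟨_, ⟨w, hw, rfl⟩, Or.inr ?_⟩
    change deriv (deriv (fun p => (pushforward c₁ c₂ c₄ ξ ψ I θ (ξ w.1, p)).2)) _ ≠ 0
    rw [hsnd _ hx]
    set q₀ := (argMap c₂ ξ ψ w).2 with hq₀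
    set k := deriv ξ w.1 / c₂ with hk
    set b := -(deriv ψ w.1 / c₂) with hb
    have hq : k * q₀ + b = w.2 := hback w hw
    have haff : ∀ q : ℝ, HasDerivAt (fun q : ℝ => k * q + b) k q := hasDerivAt_affine k b
    have hnear : ∀ᶠ q in 𝓝 q₀, (w.1, k * q + b) ∈ W := by
      have hc : ContinuousAt (fun q : ℝ => (w.1, k * q + b)) q₀ := by fun_prop
      apply hc.eventually_mem
      apply hθ.isOpen.mem_nhds
      rw [hq]
      exact hw
    -- as `f` does not depend on `u_x`, it contributes to `g̃` only terms affine in `ũ_x̃`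
    have hd1 : deriv (fun q => 1 / c₁ ^ 2 * (c₂ * (θ (w.1, k * q + b)).2 +
        (q * deriv (deriv ξ) w.1 - deriv (deriv ψ) w.1) * (θ (w.1, k * q + b)).1 + 2 * c₄))
        =ᶠ[𝓝 q₀] fun q => 1 / c₁ ^ 2 * (c₂ * (deriv (fun p => (θ (w.1, p)).2) (k * q + b) * k) +
          deriv (deriv ξ) w.1 * (θ (w.1, k * q + b)).1) := by
      filter_upwards [hnear] with q hqW
      have hd := hdiff _ hqW
      have e2 := hd.snd.hasDerivAt.comp q (haff q)
      have e1 := hd.fst.hasDerivAt.comp q (haff q)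
      have e0 : deriv (fun p => (θ (w.1, p)).1) (k * q + b) = 0 := hf _ hqW
      rw [e0, zero_mul] at e1
      have e3 := (((e2.const_mul c₂).add ((((hasDerivAt_id q).mul_const
        (deriv (deriv ξ) w.1)).sub_const (deriv (deriv ψ) w.1)).mul e1)).add_const
          (2 * c₄)).const_mul (1 / c₁ ^ 2)
      refine e3.deriv.trans ?_
      simp
    rw [hd1.deriv_eq]
    have e2 : HasDerivAt (deriv (fun p => (θ (w.1, p)).2))
        (deriv (deriv (fun p => (θ (w.1, p)).2)) w.2) (k * q₀ + b) := by
      rw [hq]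
      exact (differentiableAt_of_deriv_ne_zero hg).hasDerivAt
    have e1 : HasDerivAt (fun p => (θ (w.1, p)).1) 0 (k * q₀ + b) := by
      rw [hq, ← hf w hw]
      exact (hdiff w hw).fst.hasDerivAt
    have e3 := ((((e2.comp q₀ (haff q₀)).mul_const k).const_mul c₂).add
      ((e1.comp q₀ (haff q₀)).const_mul (deriv (deriv ξ) w.1))).const_mul (1 / c₁ ^ 2)
    have e4 := e3.deriv
    have hk0 : k ≠ 0 := div_ne_zero hξ hc₂
    rw [show deriv (fun q => 1 / c₁ ^ 2 * (c₂ * (deriv (fun p => (θ (w.1, p)).2) (k * q + b) * k) +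
      deriv (deriv ξ) w.1 * (θ (w.1, k * q + b)).1)) q₀ = _ from e4, zero_mul, mul_zero, add_zero]
    positivity

theorem pushforward_isArbitraryElement (h : IsExplicitData c₁ c₂ ξ ψ I) {θ : ℝ × ℝ → ℝ × ℝ}
    {W : Set (ℝ × ℝ)} (hθ : IsArbitraryElement θ W) (hWI : ∀ w ∈ W, w.1 ∈ I) :
    IsArbitraryElement (pushforward c₁ c₂ c₄ ξ ψ I θ) (argMap c₂ ξ ψ '' W) := by
  have hA := h.argMap_isPointTransformation
  refine ⟨hA.isOpen_image hθ.isOpen hWI, ?_, h.pushforward_nonlinear hθ hWI⟩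
  have hinv : ContDiffOn ℝ ∞ (Function.invFunOn (argMap c₂ ξ ψ) {w | w.1 ∈ I})
      (argMap c₂ ξ ψ '' W) := hA.contDiffOn_invFunOn.mono (image_mono hWI)
  have hmaps : MapsTo (Function.invFunOn (argMap c₂ ξ ψ) {w | w.1 ∈ I})
      (argMap c₂ ξ ψ '' W) W := by
    rintro _ ⟨w, hw, rfl⟩
    rwa [h.invFunOn_argMap_apply (hWI w hw)]
  exact h.contDiffOn_coefMap hinv (hθ.smooth.comp hinv hmaps) fun w hw => hWI _ (hmaps hw)

end IsExplicitData

/-! ### Maps of the explicit form are equivalence transformations -/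

theorem HasExplicitForm.isEquivalenceTransformation {Φ : Ext → Ext} {M : Set Ext} (hM : IsOpen M)
    (hD : IsPreconnected (baseDomain M)) (h : HasExplicitForm Φ M) :
    IsEquivalenceTransformation Φ M := by
  obtain ⟨c₀, c₁, c₂, c₃, c₄, ξ, ψ, hc, hξ, hψ, hξ0, hform⟩ := h
  have hI : IsPreconnected (xDomain M) := hD.image _ (by fun_prop)
  have hd : IsExplicitData c₁ c₂ ξ ψ (xDomain M) :=
    ⟨left_ne_zero_of_mul hc, right_ne_zero_of_mul hc, isOpen_xDomain hM, hξ, hψ, hξ0,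
      injOn_of_deriv_ne_zero hI hξ hξ0⟩
  have hMI : MapsTo (fun m : Ext => m.1.1.2.1) M (xDomain M) :=
    fun m hm => ⟨m.1.1, ⟨m.1, ⟨m, hm, rfl⟩, rfl⟩, rfl⟩
  have hJI : MapsTo (fun j : Jet => j.1.2.1) (jetDomain M) (xDomain M) := by
    rintro _ ⟨m, hm, rfl⟩
    exact hMI hm
  have hDI : MapsTo (fun z : Base => z.2.1) (baseDomain M) (xDomain M) := mapsTo_image _ _
  have hΦ : ∀ m ∈ M, Φ m =
      (sepJet c₂ (fun t => c₁ * t + c₀) ξ (fun t => c₄ * t ^ 2 + c₃ * t) ψ m.1,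
        coefMap c₁ c₂ c₄ ξ ψ (arg m.1) m.2) := by
    rintro ⟨⟨⟨t, x, u⟩, a, b⟩, f, g⟩ hm
    rw [hform t x u a b f g hm]
    simp only [sepJet, sepMap, deriv_affine, deriv_quadratic]
    refine Prod.ext (Prod.ext (Prod.ext rfl (Prod.ext rfl ?_)) (Prod.ext ?_ rfl)) rfl
    · simp only
      ring
    · simp only
      ring
  have hΦarg : ∀ m ∈ M, arg (Φ m).1 = argMap c₂ ξ ψ (arg m.1) := fun m hm => by
    rw [hΦ m hm]
    rfl
  have hpt := hd.isPointTransformation (c₀ := c₀) (c₃ := c₃) (c₄ := c₄) hM hMI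
  refine ⟨⟨hM, hpt.smooth.congr hΦ, hpt.injOn.congr fun m hm => (hΦ m hm).symm, ?_⟩,
    sepMap c₂ (fun t => c₁ * t + c₀) ξ (fun t => c₄ * t ^ 2 + c₃ * t) ψ,
    sepJet c₂ (fun t => c₁ * t + c₀) ξ (fun t => c₄ * t ^ 2 + c₃ * t) ψ,
    hd.sepMap_isPointTransformation (isOpen_baseDomain hM) hDI,
    hd.sepJet_isPointTransformation (isOpen_jetDomain hM) hJI,
    fun m hm => by rw [hΦ m hm]; rfl, fun m hm => by rw [hΦ m hm], ?_, ?_⟩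
  · intro m hm
    have h1 : Φ =ᶠ[𝓝 m] _ := eventuallyEq_of_mem (hM.mem_nhds hm) hΦ
    rw [h1.fderiv_eq]
    exact hpt.nondegenerate m hm
  · intro j hj
    have hr := hd.sepRegular (c₀ := c₀) (c₃ := c₃) (c₄ := c₄) (hJI hj)
    rw [totalJac_eq_of_sepMap hr.τ₁ hr.ξ₁ hr.ρ₁ hr.ψ₁ .rfl,
      newT_eq_of_sepMap hr.τ₁ hr.ξ₁ hr.ρ₁ hr.ψ₁ .rfl hr.ξ_ne,
      newX_eq_of_sepMap hr.τ₁ hr.ξ₁ hr.ρ₁ hr.ψ₁ .rfl hr.τ_ne,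
      totalT_eq_of_sepMap hr.τ₁ hr.ξ₁ hr.ρ₁ hr.ψ₁ .rfl,
      totalX_eq_of_sepMap hr.τ₁ hr.ξ₁ hr.ρ₁ hr.ψ₁ .rfl]
    exact ⟨mul_ne_zero hr.τ_ne hr.ξ_ne, rfl⟩
  · intro θ W hθ hfit
    have hWI : ∀ w ∈ W, w.1 ∈ xDomain M := by
      intro w hw
      rw [← hfit] at hw
      obtain ⟨m, ⟨hm, -, -⟩, rfl⟩ := hw
      exact hMI hm
    have himg : Φ '' graphIn θ W M = graphIn (pushforward c₁ c₂ c₄ ξ ψ (xDomain M) θ)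
        (argMap c₂ ξ ψ '' W) (Φ '' M) := by
      ext k
      constructor
      · rintro ⟨m, ⟨hm, hmW, hmθ⟩, rfl⟩
        refine ⟨⟨m, hm, rfl⟩, ?_, ?_⟩
        · rw [hΦarg m hm]
          exact mem_image_of_mem _ hmW
        · rw [hΦarg m hm, hd.pushforward_argMap θ (w := arg m.1) (hMI hm), hΦ m hm, ← hmθ]
      · rintro ⟨⟨m, hm, rfl⟩, hmW, hmθ⟩
        rw [hΦarg m hm] at hmW hmθ
        obtain ⟨w, hw, hwm⟩ := hmW
        have hwm' : w = arg m.1 :=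
          hd.argMap_isPointTransformation.injOn (hWI w hw) (hMI hm) hwm
        subst hwm'
        refine ⟨m, ⟨hm, hw, ?_⟩, rfl⟩
        rw [hd.pushforward_argMap θ (w := arg m.1) (hMI hm), hΦ m hm] at hmθ
        exact hd.coefMap_injective (w := arg m.1) (hMI hm) hmθ
    refine ⟨_, _, hd.pushforward_isArbitraryElement (c₄ := c₄) hθ hWI, ?_, himg, ?_⟩
    · rw [FitsIn, ← himg, image_image]
      conv_rhs => rw [← hfit, image_image]
      exact image_congr fun m hm => hΦarg m hm.1
    · rintro _ ⟨m, ⟨hm, hmW, hmθ⟩, rfl⟩ r s q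
      have hr := hd.sepRegular (c₀ := c₀) (c₃ := c₃) (c₄ := c₄) (hMI hm)
      have harg : arg (sepJet c₂ (fun t => c₁ * t + c₀) ξ (fun t => c₄ * t ^ 2 + c₃ * t) ψ m.1) =
        argMap c₂ ξ ψ (arg m.1) := rfl
      rw [Satisfies, Satisfies, hr.newTT_eq .rfl .rfl, hr.newXX_eq .rfl .rfl, harg,
        hd.pushforward_argMap θ (w := arg m.1) (hMI hm)]
      have h1 := hd.c₁_ne
      have h2 := hd.c₂_ne
      have h3 := hr.ξ_ne
      simp only [coefMap, arg, deriv_affine, deriv_quadratic,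
        deriv_const, zero_mul, sub_zero]
      rw [← sub_eq_zero, ← sub_eq_zero (a := (c₂ * r + 2 * c₄) / c₁ ^ 2)]
      -- the two sides of the image equation differ by `c₂ / c₁²` times those of the original one
      have h5 : (c₂ * r + 2 * c₄) / c₁ ^ 2 - (deriv ξ m.1.1.2.1 ^ 2 / c₁ ^ 2 *
          (θ (m.1.1.2.1, m.1.2.2)).1 * ((c₂ * q + deriv (deriv ψ) m.1.1.2.1 -
            deriv (deriv ξ) m.1.1.2.1 * ((c₂ * m.1.2.2 + deriv ψ m.1.1.2.1) /
              deriv ξ m.1.1.2.1)) / deriv ξ m.1.1.2.1 ^ 2) +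
          1 / c₁ ^ 2 * (c₂ * (θ (m.1.1.2.1, m.1.2.2)).2 +
            (c₂ * m.1.2.2 + deriv ψ m.1.1.2.1) / deriv ξ m.1.1.2.1 *
              deriv (deriv ξ) m.1.1.2.1 * (θ (m.1.1.2.1, m.1.2.2)).1 -
            deriv (deriv ψ) m.1.1.2.1 * (θ (m.1.1.2.1, m.1.2.2)).1 + 2 * c₄)) =
          c₂ / c₁ ^ 2 * (r - ((θ (m.1.1.2.1, m.1.2.2)).1 * q + (θ (m.1.1.2.1, m.1.2.2)).2)) := by
        field_simp
        ring
      rw [h5, mul_eq_zero]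
      exact ⟨Or.inr, fun h => h.resolve_left (div_ne_zero h2 (pow_ne_zero 2 h1))⟩

end WaveClass

theorem mainTheorem2 (Φ : WaveClass.Ext → WaveClass.Ext) (M : Set WaveClass.Ext) (hM : IsOpen M) :
    (WaveClass.IsEquivalenceTransformation Φ M →
      ∀ m ∈ M, ∃ N ⊆ M, IsOpen N ∧ m ∈ N ∧ WaveClass.HasExplicitForm Φ N) ∧
    (IsConnected (WaveClass.baseDomain M) →
      (∀ x : ℝ, IsPreconnected {z | z ∈ WaveClass.baseDomain M ∧ z.2.1 = x}) →
      (WaveClass.IsEquivalenceTransformation Φ M ↔ WaveClass.HasExplicitForm Φ M)) := by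
  refine ⟨fun h m hm => ?_, fun hD hslice =>
    ⟨fun h => h.hasExplicitForm hD hslice, fun h => h.isEquivalenceTransformation hM
      hD.isPreconnected⟩⟩
  obtain ⟨φ, φ₁, hpt⟩ := h.exists_pointwise
  exact hpt.exists_explicitForm hm
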